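/- \textbf{Channel.} Fix an integer $q$. For $t,r\in\{1,2\}$ let $\{N_{tr}[i]\}_i$ be a process with values in $\{0,1,\dots,q\}$ that is i.i.d. over time $i$, the four processes being independent of each other. In channel use $i$ transmitters 1 and 2 send vectors $W[i],X[i]\in\mathbb F_2^q$, and receivers 1 and 2 observe $$Y[i]=S^{q-N_{11}[i]}W[i]\oplus S^{q-N_{21}[i]}X[i],\qquad Z[i]=S^{q-N_{12}[i]}W[i]\oplus S^{q-N_{22}[i]}X[i],$$ where $S$ is the $q\times q$ matrix over $\mathbb F_2$ with $S_{j+1,j}=1$ for $1\le j\le q-1$ and all other entries $0$. Receiver $r$ knows the realizations of $(N_{1r}[i],N_{2r}[i])$; the transmitters know only the laws of the fading processes. A pair $(R_1,R_2)\in\mathbb R_{\ge0}^2$ is achievable if there are block codes of length $n=0,1,2,\dots$ with $\lceil 2^{nR_k}\rceil$ messages for user $k$, in which each encoder sees only its own message and decoder $r$ sees its received block together with its two fading sequences, whose probability that at least one of the two messages is decoded incorrectly, averaged over independent uniform messages and the fading, tends to $0$ as $n\to\infty$. The capacity region $\mathcal C$ is the closure of the set of achievable pairs. \textbf{Bounds.}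 Write $N_{tr}$ for a copy of $N_{tr}[i]$ (with the same time index $i$ for all $t,r$), and $[x]^+=\max(x,0)$. For $l=1,\dots,q$ let $$\alpha_1(l)=\Pr(N_{21}\ge l)-\Pr(N_{21}-N_{11}\ge l),$$ $$\beta_1(l)=[\Pr(N_{22}\ge l)-\Pr(N_{21}-N_{11}\ge l)]^+,$$ $$\gamma_1(l)=[\Pr(N_{22}-N_{12}\ge l)-\Pr(N_{21}-N_{11}\ge l)]^+,$$ and for real $\omega,\mu$ let $$B_{1a}(\omega)=\mathbb E N_{11}+\omega\,\mathbb E[N_{21}-N_{11}]^++\sum_{l=1}^q[\omega\beta_1(l)-\alpha_1(l)]^+,$$ $$B_{1b}(\omega)=(1-\omega)\mathbb E N_{11}+\omega\,\mathbb E N_{21}+\sum_{l=1}^q[\omega\gamma_1(l)-\alpha_1(l)]^++\omega\sum_{l=1}^q\max\big(\Pr(N_{11}-N_{21}\ge l),\Pr(N_{12}\ge l)\big),$$ $$B_{1c}(\omega,\mu)=\mathbb E N_{11}+\omega\,\mathbb E[N_{21}-N_{11}]^++\sum_{l=1}^q[\omega\gamma_1(l)-\alpha_1(l)]^++\sum_{l=1}^q\max\big(\mu\Pr(N_{11}\ge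 l),\,\omega\Pr(N_{12}\ge l)\big).$$ Let $$\mathcal R_{1a}=\{(R_1,R_2)\in\mathbb R_{\ge0}^2: R_1+\omega R_2\le B_{1a}(\omega)\ \text{for all }\omega\in[0,1]\},$$ $$\mathcal R_{1b}=\{(R_1,R_2)\in\mathbb R_{\ge0}^2: R_1+\omega R_2\le B_{1b}(\omega)\ \text{for all }\omega\in[0,1]\},$$ $$\mathcal R_{1c}=\{(R_1,R_2)\in\mathbb R_{\ge0}^2: (1+\mu)R_1+\omega R_2\le B_{1c}(\omega,\mu)\ \text{for all }\omega\in[0,1],\ \mu\in[0,\omega]\}.$$ Define $\alpha_2,\beta_2,\gamma_2$, $B_{2a},B_{2b},B_{2c}$ and $\mathcal R_{2a},\mathcal R_{2b},\mathcal R_{2c}$ by exchanging the subscripts $1$ and $2$ throughout (in $R_k$ as well as in $N_{tr}$). \textbf{Theorem.} $$\mathcal C\subseteq\mathcal R_{1a}\cap\mathcal R_{1b}\cap\mathcal R_{1c}\cap\mathcal R_{2a}\cap\mathcal R_{2b}\cap\mathcal R_{2c}.$$ -/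

import Mathlib

namespace LayeredErasureIC

/-! ### The channel and its capacity region

Users and receivers are indexed by `Fin 2` (user 1 is `0`, user 2 is `1`). A fading process is
`N t r i`, the number of layers that reach receiver `r` from transmitter `t` at time `i`. -/

/-- The `q × q` shift matrix over the field with two elements: the entries directly below the
diagonal are `1`, all others are `0`. -/
def shift (q : ℕ) : Matrix (Fin q) (Fin q) (ZMod 2) :=
  Matrix.of fun i j => if (i : ℕ) = (j : ℕ) + 1 then 1 else 0

/-- The signal received in one channel use, when transmitter `t` sends the vector `x t` and the
first `a t` layers of `x t` reach the receiver. -/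
def received {q : ℕ} (a : Fin 2 → Fin (q + 1)) (x : Fin 2 → Fin q → ZMod 2) : Fin q → ZMod 2 :=
  (shift q ^ (q - (a 0 : ℕ))).mulVec (x 0) + (shift q ^ (q - (a 1 : ℕ))).mulVec (x 1)

/-- A block code of length `n` with `M k` messages for user `k`. The encoders see only their own
message. The decoder of receiver `r` sees the received block and the realizations of the two
fading processes (indexed by the transmitter) towards receiver `r`. -/
structure Code (q n : ℕ) (M : Fin 2 → ℕ) where
  enc : (k : Fin 2) → Fin (M k) → Fin n → Fin q → ZMod 2
  dec : (r : Fin 2) → (Fin n → Fin q → ZMod 2) → (Fin 2 → Fin n → Fin (q + 1)) → Fin (M r)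

section Capacity

variable {Ω : Type*} [MeasurableSpace Ω] {q : ℕ}

/-- The message that receiver `r` decides for, if `m` is the pair of messages sent and `ω` is the
outcome of the fading. -/
def Code.decoded {n : ℕ} {M : Fin 2 → ℕ} (c : Code q n M)
    (N : Fin 2 → Fin 2 → ℕ → Ω → Fin (q + 1)) (m : (k : Fin 2) → Fin (M k)) (ω : Ω)
    (r : Fin 2) : Fin (M r) :=
  c.dec r (fun i => received (fun t => N t r i ω) (fun t => c.enc t (m t) i))
    (fun t i => N t r i ω)

/-- The average probability of error: the probability that at least one receiver decodes its
message wrongly, when the two messages are uniform, independent of each other and of the fading. -/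
noncomputable def Code.errorProb {n : ℕ} {M : Fin 2 → ℕ} (c : Code q n M) (P : MeasureTheory.Measure Ω)
    (N : Fin 2 → Fin 2 → ℕ → Ω → Fin (q + 1)) : ℝ :=
  ((M 0 : ℝ) * (M 1 : ℝ))⁻¹ *
    ∑ m : (k : Fin 2) → Fin (M k), P.real {ω | ∃ r, c.decoded N m ω r ≠ m r}

/-- The rate pair `R` (in bits per channel use) is achievable: there are codes of every block
length `n` with `⌈2 ^ (n R k)⌉` messages for user `k` whose error probabilities tend to `0`. -/
def Achievable (P : MeasureTheory.Measure Ω) (N : Fin 2 → Fin 2 → ℕ → Ω → Fin (q + 1))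
    (R : Fin 2 → ℝ) : Prop :=
  (∀ k, 0 ≤ R k) ∧
    ∃ c : (n : ℕ) → Code q n (fun k => ⌈(2 : ℝ) ^ ((n : ℝ) * R k)⌉₊),
      Filter.Tendsto (fun n => (c n).errorProb P N) Filter.atTop (nhds 0)

/-- The capacity region: the closure of the set of achievable rate pairs. -/
def capacityRegion (P : MeasureTheory.Measure Ω) (N : Fin 2 → Fin 2 → ℕ → Ω → Fin (q + 1)) :
    Set (Fin 2 → ℝ) :=
  closure {R | Achievable P N R}

end Capacity

/-! ### The outer bounds

In this part `N t r` is the fading level from `t` to `r` in a single channel use. The objects for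
user `k` are written with `k` and the other user `other k`; `k = 1` is obtained from `k = 0` by
exchanging the two subscripts. -/

/-- The other user. -/
def other (k : Fin 2) : Fin 2 := 1 - k

section Bounds

variable {Ω : Type*} [MeasurableSpace Ω] {q : ℕ}

/-- The probability that `X ≥ l`. -/
noncomputable def tail (P : MeasureTheory.Measure Ω) (X : Ω → ℤ) (l : ℕ) : ℝ :=
  P.real {ω | (l : ℤ) ≤ X ω}

/-- The fading level from `t` to `r` as an integer valued random variable. -/
def level (N : Fin 2 → Fin 2 → Ω → Fin (q + 1)) (t r : Fin 2) : Ω → ℤ :=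
  fun ω => ((N t r ω : ℕ) : ℤ)

/-- The expected value of an integer valued random variable. -/
noncomputable def mean (P : MeasureTheory.Measure Ω) (X : Ω → ℤ) : ℝ :=
  ∫ ω, (X ω : ℝ) ∂P

variable (P : MeasureTheory.Measure Ω) (N : Fin 2 → Fin 2 → Ω → Fin (q + 1)) (k : Fin 2)

noncomputable def alpha (l : ℕ) : ℝ :=
  tail P (level N (other k) k) l - tail P (level N (other k) k - level N k k) l

noncomputable def beta (l : ℕ) : ℝ :=
  max (tail P (level N (other k) (other k)) l -
    tail P (level N (other k) k - level N k k) l) 0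

noncomputable def gamma (l : ℕ) : ℝ :=
  max (tail P (level N (other k) (other k) - level N k (other k)) l -
    tail P (level N (other k) k - level N k k) l) 0

noncomputable def boundA (w : ℝ) : ℝ :=
  mean P (level N k k) +
    w * mean P (fun ω => max (level N (other k) k ω - level N k k ω) 0) +
    ∑ l ∈ Finset.Icc 1 q, max (w * beta P N k l - alpha P N k l) 0

noncomputable def boundB (w : ℝ) : ℝ :=
  (1 - w) * mean P (level N k k) + w * mean P (level N (other k) k) +
    ∑ l ∈ Finset.Icc 1 q, max (w * gamma P N k l - alpha P N k l) 0 +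
    w * ∑ l ∈ Finset.Icc 1 q,
      max (tail P (level N k k - level N (other k) k) l) (tail P (level N k (other k)) l)

noncomputable def boundC (w u : ℝ) : ℝ :=
  mean P (level N k k) +
    w * mean P (fun ω => max (level N (other k) k ω - level N k k ω) 0) +
    ∑ l ∈ Finset.Icc 1 q, max (w * gamma P N k l - alpha P N k l) 0 +
    ∑ l ∈ Finset.Icc 1 q,
      max (u * tail P (level N k k) l) (w * tail P (level N k (other k)) l)

/-- The region `ℛ_ka`. -/
def regionA : Set (Fin 2 → ℝ) :=
  {R | (∀ j, 0 ≤ R j) ∧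
    ∀ w ∈ Set.Icc (0 : ℝ) 1, R k + w * R (other k) ≤ boundA P N k w}

/-- The region `ℛ_kb`. -/
def regionB : Set (Fin 2 → ℝ) :=
  {R | (∀ j, 0 ≤ R j) ∧
    ∀ w ∈ Set.Icc (0 : ℝ) 1, R k + w * R (other k) ≤ boundB P N k w}

/-- The region `ℛ_kc`. -/
def regionC : Set (Fin 2 → ℝ) :=
  {R | (∀ j, 0 ≤ R j) ∧
    ∀ w ∈ Set.Icc (0 : ℝ) 1, ∀ u ∈ Set.Icc (0 : ℝ) w,
      (1 + u) * R k + w * R (other k) ≤ boundC P N k w u}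

end Bounds

end LayeredErasureIC

/-!
The bounds follow from Fano's inequality and one fact about entropies of the top layers of a block.

For a block `U` of random vectors, let `F p` be the average entropy of the first `N i` layers of
`U` at the times `i`, where the `N i` are independent with tail function `p` (`levelAvg` of
`topEnt`). The entropy `topEnt U` is a monotone submodular function of the numbers of layers, and
each layer adds at most `log 2`. Hence `F` is monotone in `p`, raising `p` by `t` raises it by at
most `n * log 2 * ∑ l, t l`, and `F` is concave along nonnegative directions (`levelAvg_concave`).
Together this bounds `w * F a + (1 - w) * F d - F b` for any three tail functions
(`levelAvg_compare`), and the positive parts in the bounds of the theorem arise here.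

Given the fading levels and the message of user `r`, the block at receiver `r` is equivalent to
the layers that arrive from the other user. So Fano's inequality bounds the rate of user `r` by the
entropy of the received block minus `F` of the interference (`Code.log_card_add_topAvg_le`). The
entropy of the received block is estimated by splitting the block into the layers of one user
that lie above all layers of the other one, and the remaining bits (`Code.outputEnt_le`), or into
the arriving layers of the two users (`Code.outputEnt_le_add`). Each of the three bounds is a linear
combination of these inequalities, with the differences of values of `F` estimated by
the comparison above (`Code.converseA`, `Code.converseB`, `Code.converseC`).

Entropies are in nats, hence the factor `log 2`. Since the messages are uniform on a finite type and
independent of the fading, all entropies are those of functions on a finite type with the uniform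
law, computed for fixed fading levels and then integrated over the fading.
-/

namespace LayeredErasureIC

/-! ### Averages over independent fading levels -/

section LevelAvg

/-- `p l` is the probability that a random level with values in `{0, …, q}` is at least `l`. -/
structure IsTail (q : ℕ) (p : ℕ → ℝ) : Prop where
  zero : p 0 = 1
  top : p (q + 1) = 0
  anti : Antitone p

/-- The expected value of `φ (N₁, …, Nₙ)` when the `Nᵢ` are independent with values in
`{0, …, q}` and all have the tail function `p`. -/
noncomputable def levelAvg (q : ℕ) (p : ℕ → ℝ) {n : ℕ} (φ : (Fin n → ℕ) → ℝ) : ℝ :=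
  ∑ j : Fin n → Fin (q + 1), (∏ i, (p (j i) - p (j i + 1))) * φ (fun i => j i)

/-- A submodular function on a lattice. -/
def Submod {L : Type*} [Lattice L] (φ : L → ℝ) : Prop :=
  ∀ u v, φ (u ⊔ v) + φ (u ⊓ v) ≤ φ u + φ v

variable {q n : ℕ} {a b c p : ℕ → ℝ}

lemma IsTail.mass_nonneg (hp : IsTail q p) (l : ℕ) : 0 ≤ p l - p (l + 1) :=
  sub_nonneg.2 (hp.anti (Nat.le_succ l))

lemma IsTail.sum_mass (hp : IsTail q p) : ∑ l ∈ Finset.range (q + 1), (p l - p (l + 1)) = 1 := by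
  rw [Finset.sum_range_sub', hp.zero, hp.top, sub_zero]

lemma IsTail.max (ha : IsTail q a) (hb : IsTail q b) : IsTail q (fun l => max (a l) (b l)) :=
  ⟨by simp [ha.zero, hb.zero], by simp [ha.top, hb.top],
    fun _ _ h => max_le_max (ha.anti h) (hb.anti h)⟩

lemma IsTail.mix (ha : IsTail q a) (hb : IsTail q b) {w : ℝ} (h0 : 0 ≤ w) (h1 : w ≤ 1) :
    IsTail q (fun l => w * a l + (1 - w) * b l) :=
  ⟨by simp [ha.zero, hb.zero], by simp [ha.top, hb.top],
    fun _ _ h => add_le_add (mul_le_mul_of_nonneg_left (ha.anti h) h0)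
      (mul_le_mul_of_nonneg_left (hb.anti h) (by linarith))⟩

/-- Summation by parts: the mean of `ψ` in terms of the tail function. -/
lemma sum_mass_mul (m : ℕ) (ψ : ℕ → ℝ) :
    ∑ l ∈ Finset.range (m + 1), (p l - p (l + 1)) * ψ l =
      p 0 * ψ 0 - p (m + 1) * ψ m +
        ∑ l ∈ Finset.range m, p (l + 1) * (ψ (l + 1) - ψ l) := by
  induction m with
  | zero => simp [sub_mul]
  | succ m ih => rw [Finset.sum_range_succ, ih, Finset.sum_range_succ _ m]; ring

lemma sum_mass_mul_mono (ha : IsTail q a) (hb : IsTail q b) (hab : ∀ l, a l ≤ b l) {ψ : ℕ → ℝ}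
    (hψ : Monotone ψ) :
    ∑ l ∈ Finset.range (q + 1), (a l - a (l + 1)) * ψ l ≤
      ∑ l ∈ Finset.range (q + 1), (b l - b (l + 1)) * ψ l := by
  rw [sum_mass_mul, sum_mass_mul, ha.zero, hb.zero, ha.top, hb.top]
  gcongr with l
  · exact sub_nonneg.2 (hψ (Nat.le_succ l))
  · exact hab _

lemma levelAvg_zero (φ : (Fin 0 → ℕ) → ℝ) : levelAvg q p φ = φ Fin.elim0 := by
  simp only [levelAvg, Finset.univ_unique, Finset.sum_singleton, Finset.univ_eq_empty,
    Finset.prod_empty, one_mul]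
  congr 1
  exact Subsingleton.elim _ _

lemma levelAvg_sub (φ ψ : (Fin n → ℕ) → ℝ) :
    levelAvg q p (fun v => φ v - ψ v) = levelAvg q p φ - levelAvg q p ψ := by
  simp only [levelAvg, mul_sub, Finset.sum_sub_distrib]

lemma levelAvg_add (φ ψ : (Fin n → ℕ) → ℝ) :
    levelAvg q p (fun v => φ v + ψ v) = levelAvg q p φ + levelAvg q p ψ := by
  simp only [levelAvg, mul_add, Finset.sum_add_distrib]

lemma levelAvg_mul (r : ℝ) (φ : (Fin n → ℕ) → ℝ) :
    levelAvg q p (fun v => r * φ v) = r * levelAvg q p φ := by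
  simp only [levelAvg, Finset.mul_sum]
  exact Finset.sum_congr rfl fun _ _ => by ring

lemma levelAvg_sum {ι : Type*} (s : Finset ι) (φ : ι → (Fin n → ℕ) → ℝ) :
    levelAvg q p (fun v => ∑ i ∈ s, φ i v) = ∑ i ∈ s, levelAvg q p (φ i) := by
  simp only [levelAvg, Finset.mul_sum]
  exact Finset.sum_comm

lemma levelAvg_mono_fun (hp : IsTail q p) {φ ψ : (Fin n → ℕ) → ℝ} (h : ∀ v, φ v ≤ ψ v) :
    levelAvg q p φ ≤ levelAvg q p ψ :=
  Finset.sum_le_sum fun _ _ => mul_le_mul_of_nonneg_left (h _)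
    (Finset.prod_nonneg fun _ _ => hp.mass_nonneg _)

lemma levelAvg_succ (φ : (Fin (n + 1) → ℕ) → ℝ) :
    levelAvg q p φ = ∑ l ∈ Finset.range (q + 1),
      (p l - p (l + 1)) * levelAvg q p (fun v => φ (Fin.cons l v)) := by
  rw [← Fin.sum_univ_eq_sum_range
    (fun l => (p l - p (l + 1)) * levelAvg q p (fun v => φ (Fin.cons l v)))]
  simp only [levelAvg, Finset.mul_sum]
  rw [← (Fin.consEquiv fun _ : Fin (n + 1) => Fin (q + 1)).sum_comp, Fintype.sum_prod_type]
  refine Finset.sum_congr rfl fun l _ => Finset.sum_congr rfl fun v _ => ?_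
  rw [Fin.prod_univ_succ]
  simp only [Fin.consEquiv_apply, Fin.cons_zero, Fin.cons_succ, mul_assoc]
  congr 3
  funext i
  refine Fin.cases ?_ (fun i => ?_) i <;> simp

lemma levelAvg_succ' (φ : (Fin (n + 1) → ℕ) → ℝ) :
    levelAvg q p φ = levelAvg q p fun v => ∑ l ∈ Finset.range (q + 1),
      (p l - p (l + 1)) * φ (Fin.cons l v) := by
  rw [levelAvg_succ, levelAvg_sum]
  simp only [levelAvg_mul]

lemma levelAvg_const (hp : IsTail q p) (r : ℝ) : levelAvg q p (fun _ : Fin n → ℕ => r) = r := by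
  induction n with
  | zero => rw [levelAvg_zero]
  | succ n ih => rw [levelAvg_succ]; simp only [ih]; rw [← Finset.sum_mul, hp.sum_mass, one_mul]

/-- Larger tails give larger averages of monotone functions (stochastic dominance). -/
lemma levelAvg_mono_tail (ha : IsTail q a) (hb : IsTail q b) (hab : ∀ l, a l ≤ b l)
    {ψ : (Fin n → ℕ) → ℝ} (hψ : Monotone ψ) : levelAvg q a ψ ≤ levelAvg q b ψ := by
  induction n with
  | zero => rw [levelAvg_zero, levelAvg_zero]
  | succ n ih =>
    rw [levelAvg_succ, levelAvg_succ]
    calc _ ≤ ∑ l ∈ Finset.range (q + 1),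
          (a l - a (l + 1)) * levelAvg q b (fun v => ψ (Fin.cons l v)) := by
          refine Finset.sum_le_sum fun l _ => mul_le_mul_of_nonneg_left (ih ?_) (ha.mass_nonneg l)
          exact fun u v h => hψ (Fin.cons_le_cons.2 ⟨le_rfl, h⟩)
      _ ≤ _ := sum_mass_mul_mono ha hb hab fun k l h => levelAvg_mono_fun hb fun v =>
          hψ (Fin.cons_le_cons.2 ⟨h, le_rfl⟩)

lemma levelAvg_sum_levels (hp : IsTail q p) :
    levelAvg q p (fun v : Fin n → ℕ => ∑ i, (v i : ℝ)) = n * ∑ l ∈ Finset.Icc 1 q, p l := by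
  have h1 : ∑ l ∈ Finset.range (q + 1), (p l - p (l + 1)) * (l : ℝ) =
      ∑ l ∈ Finset.Icc 1 q, p l := by
    rw [sum_mass_mul, hp.top, ← Finset.Ico_add_one_right_eq_Icc, Finset.sum_Ico_eq_sum_range]
    simp [add_comm]
  induction n with
  | zero => simp [levelAvg_zero]
  | succ n ih =>
    rw [levelAvg_succ]
    simp only [Fin.sum_univ_succ, Fin.cons_zero, Fin.cons_succ, levelAvg_add, levelAvg_const hp,
      ih, mul_add, Finset.sum_add_distrib]
    rw [h1, ← Finset.sum_mul, hp.sum_mass]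
    push_cast; ring

lemma cons_sup_cons (k l : ℕ) (u v : Fin n → ℕ) :
    (Fin.cons k u ⊔ Fin.cons l v : Fin (n + 1) → ℕ) = Fin.cons (k ⊔ l) (u ⊔ v) := by
  funext i
  refine Fin.cases ?_ (fun i => ?_) i <;> simp

lemma cons_inf_cons (k l : ℕ) (u v : Fin n → ℕ) :
    (Fin.cons k u ⊓ Fin.cons l v : Fin (n + 1) → ℕ) = Fin.cons (k ⊓ l) (u ⊓ v) := by
  funext i
  refine Fin.cases ?_ (fun i => ?_) i <;> simp

/-- The average of a submodular function is concave along nonnegative directions in the space of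
tail functions. -/
lemma levelAvg_concave (ha : IsTail q a) (hc : IsTail q c) (hca : ∀ l, c l ≤ a l) {w : ℝ}
    (h0 : 0 ≤ w) (h1 : w ≤ 1) {φ : (Fin n → ℕ) → ℝ} (hφ : Submod φ) :
    w * levelAvg q a φ + (1 - w) * levelAvg q c φ ≤
      levelAvg q (fun l => w * a l + (1 - w) * c l) φ := by
  induction n with
  | zero => simp only [levelAvg_zero]; linarith
  | succ n ih =>
    have hd := ha.mix hc h0 h1
    -- Averaging the first level out leaves a submodular function of the others.
    set M : (ℕ → ℝ) → (Fin n → ℕ) → ℝ := fun p v =>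
      ∑ l ∈ Finset.range (q + 1), (p l - p (l + 1)) * φ (Fin.cons l v) with hM
    have hMs : Submod (M fun l => w * a l + (1 - w) * c l) := by
      intro u v
      simp only [hM, ← Finset.sum_add_distrib, ← mul_add]
      refine Finset.sum_le_sum fun l _ => mul_le_mul_of_nonneg_left ?_ (hd.mass_nonneg l)
      have := hφ (Fin.cons l u) (Fin.cons l v)
      rwa [cons_sup_cons, cons_inf_cons, sup_idem, inf_idem] at this
    have hmix : ∀ v, M (fun l => w * a l + (1 - w) * c l) v = w * M a v + (1 - w) * M c v := by
      intro v
      simp only [hM, Finset.mul_sum, ← Finset.sum_add_distrib]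
      exact Finset.sum_congr rfl fun l _ => by ring
    -- The gain from raising the first level decreases in the other levels.
    have hanti : Monotone fun v => M c v - M a v := by
      intro u v huv
      have := sum_mass_mul_mono hc ha hca
        (ψ := fun l => φ (Fin.cons l u) - φ (Fin.cons l v)) (fun k l hkl => by
          have := hφ (Fin.cons l u) (Fin.cons k v)
          rw [cons_sup_cons, cons_inf_cons, sup_eq_left.2 hkl, sup_eq_right.2 huv,
            inf_eq_right.2 hkl, inf_eq_left.2 huv] at this
          simp only
          linarith)
      simp only [mul_sub, Finset.sum_sub_distrib] at this
      simp only [hM]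
      linarith
    have hdiff := levelAvg_mono_tail hc ha hca hanti
    simp only [levelAvg_sub] at hdiff
    have hI := ih hMs
    have e : ∀ p', levelAvg q p' (M fun l => w * a l + (1 - w) * c l) =
        w * levelAvg q p' (M a) + (1 - w) * levelAvg q p' (M c) := by
      intro p'
      rw [← levelAvg_mul, ← levelAvg_mul, ← levelAvg_add]
      exact congrArg _ (funext hmix)
    rw [levelAvg_succ' (p := a), levelAvg_succ' (p := c),
      levelAvg_succ' (p := fun l => w * a l + (1 - w) * c l)]
    change w * levelAvg q a (M a) + (1 - w) * levelAvg q c (M c) ≤ levelAvg q _ (M _)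
    refine le_trans ?_ hI
    rw [e, e]
    nlinarith [mul_nonneg (mul_nonneg h0 (sub_nonneg.2 h1)) (sub_nonneg.2 hdiff)]

/-- The comparison of three fading laws behind all the bounds. By concavity the left side is at
most a difference of two averages, and raising the tail by `t` raises an average by at most
`n * B * t`. -/
lemma levelAvg_compare (ha : IsTail q a) (hb : IsTail q b) (hc : IsTail q c) {w B : ℝ}
    (h0 : 0 ≤ w) (h1 : w ≤ 1) {φ : (Fin n → ℕ) → ℝ} (hφ : Submod φ) (hmono : Monotone φ)
    (hB : Monotone fun v : Fin n → ℕ => B * ∑ i, (v i : ℝ) - φ v) :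
    w * levelAvg q a φ + (1 - w) * levelAvg q c φ - levelAvg q b φ ≤
      n * B * ∑ l ∈ Finset.Icc 1 q, max (w * max (a l - c l) 0 - (b l - c l)) 0 := by
  have hm := ha.max hc
  have hd := hm.mix hc h0 h1
  have he := hd.max hb
  have s1 := levelAvg_mono_tail ha hm (fun l => le_max_left _ _) hmono
  have s2 := levelAvg_concave hm hc (fun l => le_max_right _ _) h0 h1 hφ
  have s3 := levelAvg_mono_tail hd he (fun l => le_max_left _ _) hmono
  have s4 := levelAvg_mono_tail hb he (fun l => le_max_right _ _) hB
  simp only [levelAvg_sub, levelAvg_mul, levelAvg_sum_levels hb, levelAvg_sum_levels he] at s4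
  have s5 : ∑ l ∈ Finset.Icc 1 q, max (w * max (a l - c l) 0 - (b l - c l)) 0 =
      ∑ l ∈ Finset.Icc 1 q, max (w * max (a l) (c l) + (1 - w) * c l) (b l) -
        ∑ l ∈ Finset.Icc 1 q, b l := by
    rw [← Finset.sum_sub_distrib]
    refine Finset.sum_congr rfl fun l _ => ?_
    have e1 : max (a l - c l) 0 = max (a l) (c l) - c l := by
      rw [← max_sub_sub_right, sub_self]
    have e2 : max (w * max (a l) (c l) + (1 - w) * c l) (b l) - b l =
        max (w * max (a l) (c l) + (1 - w) * c l - b l) 0 := by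
      rw [← max_sub_sub_right, sub_self]
    rw [e1, e2]
    exact congrArg₂ max (by ring) rfl
  rw [s5]
  have s6 := mul_le_mul_of_nonneg_left s1 h0
  linarith

end LevelAvg

/-! ### Entropy of functions of a uniform random variable -/

section Entropy

open Classical in
/-- The number of arguments at which `f` has the same value as at `a`. -/
noncomputable def fiberCard {A B : Type*} [Fintype A] (f : A → B) (a : A) : ℕ :=
  (Finset.univ.filter fun x => f x = f a).card

/-- The Shannon entropy (in nats) of `f a`, where `a` is uniform on the finite type `A`. The joint
entropy of `f` and `g` is the entropy of `fun a => (f a, g a)`. -/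
noncomputable def ent {A B : Type*} [Fintype A] (f : A → B) : ℝ :=
  (Fintype.card A : ℝ)⁻¹ * ∑ a, Real.log (Fintype.card A / fiberCard f a)

variable {A B C D : Type*} [Fintype A]

lemma fiberCard_pos (f : A → B) (a : A) : 0 < fiberCard f a :=
  Finset.card_pos.2 ⟨a, by simp⟩

lemma fiberCard_cast_pos (f : A → B) (a : A) : (0 : ℝ) < fiberCard f a :=
  Nat.cast_pos.2 (fiberCard_pos f a)

lemma fiberCard_congr (f : A → B) {a b : A} (h : f a = f b) : fiberCard f a = fiberCard f b := by
  unfold fiberCard; rw [h]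

lemma fiberCard_mono {f : A → B} {g : A → C} (h : ∀ a b, f a = f b → g a = g b) (a : A) :
    fiberCard f a ≤ fiberCard g a := by
  classical
  refine Finset.card_le_card fun x => ?_
  simpa using h x a

/-- Data processing: a function of `f` has at most the entropy of `f`. -/
lemma ent_mono {f : A → B} {g : A → C} (h : ∀ a b, f a = f b → g a = g b) : ent g ≤ ent f := by
  refine mul_le_mul_of_nonneg_left (Finset.sum_le_sum fun a _ => ?_) (by positivity)
  have : 0 < Fintype.card A := Fintype.card_pos_iff.2 ⟨a⟩
  have h1 := fiberCard_cast_pos f a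
  have h2 := fiberCard_cast_pos g a
  gcongr
  exact fiberCard_mono h a

lemma ent_congr {f : A → B} {g : A → C} (h : ∀ a b, f a = f b ↔ g a = g b) : ent f = ent g :=
  le_antisymm (ent_mono fun a b => (h a b).2) (ent_mono fun a b => (h a b).1)

lemma ent_nonneg (f : A → B) : 0 ≤ ent f := by
  refine mul_nonneg (by positivity) (Finset.sum_nonneg fun a _ => Real.log_nonneg ?_)
  rw [one_le_div (fiberCard_cast_pos f a)]
  exact_mod_cast Finset.card_le_univ _

lemma ent_const [Nonempty A] (b : B) : ent (fun _ : A => b) = 0 := by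
  have : (Fintype.card A : ℝ) ≠ 0 := by simp
  simp [ent, fiberCard, this]

/-- Each fiber of `f` has total weight one if its points are weighted by the inverse of its size. -/
lemma sum_inv_fiberCard_eq_one (f : A → B) (a : A) :
    open Classical in
    ∑ x ∈ Finset.univ.filter (fun x => f x = f a), (fiberCard f x : ℝ)⁻¹ = 1 := by
  classical
  rw [Finset.sum_congr rfl (g := fun _ => (fiberCard f a : ℝ)⁻¹)
    (fun x hx => by rw [fiberCard_congr f (Finset.mem_filter.1 hx).2]), Finset.sum_const,
    nsmul_eq_mul]
  have : (Finset.univ.filter fun x => f x = f a).card = fiberCard f a := by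
    unfold fiberCard; congr
  rw [this, mul_inv_cancel₀ (fiberCard_cast_pos f a).ne']

lemma sum_inv_fiberCard_le_one (f : A → B) (b : B) :
    open Classical in
    ∑ x ∈ Finset.univ.filter (fun x => f x = b), (fiberCard f x : ℝ)⁻¹ ≤ 1 := by
  classical
  by_cases h : ∃ a, f a = b
  · obtain ⟨a, rfl⟩ := h
    exact (sum_inv_fiberCard_eq_one f a).le
  · rw [Finset.filter_false_of_mem fun x _ hx => h ⟨x, hx⟩]
    simp

/-- Gibbs' inequality: the entropy is at most the cross entropy with respect to any weight `s`,
where the condition says that the weights of the values of `f` add up to at most one. -/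
lemma ent_le_cross (f : A → B) (s : A → ℝ) (hs : ∀ a, 0 < s a)
    (hsum : ∑ a, s a / fiberCard f a ≤ 1) :
    ent f ≤ (Fintype.card A : ℝ)⁻¹ * ∑ a, -Real.log (s a) := by
  rcases isEmpty_or_nonempty A with hA | hA
  · simp [ent]
  have hN : (0 : ℝ) < Fintype.card A := by exact_mod_cast Fintype.card_pos
  refine mul_le_mul_of_nonneg_left ?_ (by positivity)
  rw [← sub_nonpos, ← Finset.sum_sub_distrib]
  calc _ ≤ ∑ a, (Fintype.card A * (s a / fiberCard f a) - 1) := by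
        refine Finset.sum_le_sum fun a _ => ?_
        have h1 := fiberCard_cast_pos f a
        have h2 := hs a
        rw [sub_neg_eq_add, ← Real.log_mul (by positivity) h2.ne', div_mul_eq_mul_div, mul_div_assoc]
        exact Real.log_le_sub_one_of_pos (by positivity)
    _ = Fintype.card A * ∑ a, s a / fiberCard f a - Fintype.card A := by
        rw [Finset.sum_sub_distrib, Finset.mul_sum]; simp
    _ ≤ 0 := by nlinarith

/-- Submodularity: conditional mutual information is nonnegative. Here `h` is a common function of
`f` and `g`. -/
lemma ent_submod (f : A → B) (g : A → C) (h : A → D) (hf : ∀ a b, f a = f b → h a = h b)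
    (hg : ∀ a b, g a = g b → h a = h b) :
    ent (fun a => (f a, g a)) + ent h ≤ ent f + ent g := by
  classical
  rcases isEmpty_or_nonempty A with hA | hA
  · simp [ent]
  have hN : (0 : ℝ) < Fintype.card A := by exact_mod_cast Fintype.card_pos
  set N : ℝ := ((Fintype.card A : ℕ) : ℝ)
  set fg : A → B × C := fun a => (f a, g a)
  have key : ∑ a, (fiberCard f a * fiberCard g a / (fiberCard h a * N)) / fiberCard fg a ≤ 1 := by
    -- Expand the two numerators as counts of pairs `(x, y)` and sum over `a` first.
    have e1 : ∀ a, (fiberCard f a * fiberCard g a / (fiberCard h a * N)) / (fiberCard fg a : ℝ) =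
        ∑ x, ∑ y, if f x = f a ∧ g y = g a then
          (N⁻¹ * (fiberCard h a : ℝ)⁻¹ * (fiberCard fg a : ℝ)⁻¹) else 0 := by
      intro a
      have : (fiberCard f a * fiberCard g a : ℝ) =
          ∑ x, ∑ y, if f x = f a ∧ g y = g a then 1 else 0 := by
        simp only [fiberCard, Finset.card_filter, Nat.cast_sum, Finset.sum_mul_sum]
        refine Finset.sum_congr rfl fun x _ => Finset.sum_congr rfl fun y _ => ?_
        by_cases h1 : f x = f a <;> by_cases h2 : g y = g a <;> simp [h1, h2]
      rw [this, div_div, Finset.sum_div]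
      refine Finset.sum_congr rfl fun x _ => ?_
      rw [Finset.sum_div]
      refine Finset.sum_congr rfl fun y _ => ?_
      split_ifs
      · rw [one_div, mul_inv, mul_inv]; ring
      · simp
    simp only [e1]
    rw [Finset.sum_comm]
    have e2 : ∀ x, ∑ a, (∑ y, if f x = f a ∧ g y = g a then
        (N⁻¹ * (fiberCard h a : ℝ)⁻¹ * (fiberCard fg a : ℝ)⁻¹) else 0) ≤ N⁻¹ := by
      intro x
      rw [Finset.sum_comm]
      calc _ ≤ ∑ y, if h y = h x then N⁻¹ * (fiberCard h y : ℝ)⁻¹ else 0 := by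
            refine Finset.sum_le_sum fun y _ => ?_
            split_ifs with hxy
            · have := mul_le_mul_of_nonneg_left (sum_inv_fiberCard_le_one fg (f x, g y))
                (a := N⁻¹ * (fiberCard h y : ℝ)⁻¹) (by positivity)
              rw [mul_one] at this
              refine le_trans (le_of_eq ?_) this
              rw [Finset.mul_sum, Finset.sum_filter]
              refine Finset.sum_congr rfl fun a _ => ?_
              by_cases hh : f x = f a ∧ g y = g a
              · rw [if_pos hh, if_pos (Prod.ext hh.1.symm hh.2.symm),
                  fiberCard_congr h (hg _ _ hh.2)]
              · rw [if_neg hh, if_neg]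
                intro he
                exact hh ⟨(congrArg Prod.fst he).symm, (congrArg Prod.snd he).symm⟩
            · refine le_of_eq (Finset.sum_eq_zero fun a _ => if_neg fun hh => hxy ?_)
              exact (hg _ _ hh.2).trans (hf _ _ hh.1).symm
        _ = N⁻¹ := by
            rw [← Finset.sum_filter, ← Finset.mul_sum, sum_inv_fiberCard_eq_one, mul_one]
    calc _ ≤ ∑ _x : A, N⁻¹ := Finset.sum_le_sum fun x _ => e2 x
      _ = 1 := by
        rw [Finset.sum_const, nsmul_eq_mul, Finset.card_univ]
        exact mul_inv_cancel₀ hN.ne'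
  have hpos : ∀ a, (0 : ℝ) < fiberCard f a * fiberCard g a / (fiberCard h a * N) := by
    intro a
    have h1 := fiberCard_cast_pos f a
    have h2 := fiberCard_cast_pos g a
    have h3 := fiberCard_cast_pos h a
    positivity
  have := ent_le_cross fg _ hpos key
  refine le_trans (add_le_add_left this _) (le_of_eq ?_)
  simp only [ent, ← mul_add, ← Finset.sum_add_distrib]
  congr 1
  refine Finset.sum_congr rfl fun a _ => ?_
  have h1 := (fiberCard_cast_pos f a).ne'
  have h2 := (fiberCard_cast_pos g a).ne'
  have h3 := (fiberCard_cast_pos h a).ne'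
  rw [Real.log_div (by positivity) (by positivity), Real.log_mul h1 h2, Real.log_mul h3 hN.ne',
    Real.log_div hN.ne' h1, Real.log_div hN.ne' h2, Real.log_div hN.ne' h3]
  ring

lemma ent_prod_le [Nonempty A] (f : A → B) (g : A → C) :
    ent (fun a => (f a, g a)) ≤ ent f + ent g := by
  have := ent_submod f g (fun _ => ()) (by simp) (by simp)
  rwa [ent_const, add_zero] at this

lemma ent_le_log_card [Fintype B] [Nonempty A] (f : A → B) :
    ent f ≤ Real.log (Fintype.card B) := by
  classical
  have hB : (0 : ℝ) < Fintype.card B := by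
    exact_mod_cast Fintype.card_pos_iff.2 ⟨f (Classical.arbitrary A)⟩
  have hN : (Fintype.card A : ℝ) ≠ 0 := by simp
  refine (ent_le_cross f (fun _ => (Fintype.card B : ℝ)⁻¹) (fun _ => by positivity) ?_).trans ?_
  · simp only [div_eq_mul_inv, ← Finset.mul_sum]
    rw [← Finset.sum_fiberwise (g := f)]
    calc _ ≤ (Fintype.card B : ℝ)⁻¹ * ∑ _b : B, 1 := by
          gcongr with b
          exact sum_inv_fiberCard_le_one f b
      _ = 1 := by simp [hB.ne']
  · rw [Real.log_inv, neg_neg, Finset.sum_const, nsmul_eq_mul, Finset.card_univ,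
      inv_mul_cancel_left₀ hN]

/-- Fano's inequality: if `m` can be guessed from `y` with error probability `ε`, then the
conditional entropy of `m` given `y` is at most `log 2 + ε log |B|`. -/
lemma ent_fano [Fintype B] [Nonempty A] (m : A → B) (y : A → C) (g : C → B) :
    open Classical in
    ent (fun a => (m a, y a)) ≤ ent y + Real.log 2 + (Fintype.card A : ℝ)⁻¹ *
      (Finset.univ.filter fun a => g (y a) ≠ m a).card * Real.log (Fintype.card B) := by
  classical
  have hB : (0 : ℝ) < Fintype.card B := by
    exact_mod_cast Fintype.card_pos_iff.2 ⟨m (Classical.arbitrary A)⟩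
  have hN : (0 : ℝ) < Fintype.card A := by exact_mod_cast Fintype.card_pos
  set N : ℝ := ((Fintype.card A : ℕ) : ℝ)
  set K : ℝ := ((Fintype.card B : ℕ) : ℝ)
  -- The law of `m` given `y` is compared with an equal mixture of the guess and the uniform law.
  set w : C → B → ℝ := fun c b => if g c = b then 1 / 2 else (2 * K)⁻¹
  have hw : ∀ c b, 0 < w c b := fun c b => by simp only [w]; split_ifs <;> positivity
  have hw1 : ∀ c, ∑ b, w c b ≤ 1 := by
    intro c
    calc ∑ b, w c b ≤ ∑ b, ((if g c = b then 1 / 2 else 0) + (2 * K)⁻¹) := by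
          refine Finset.sum_le_sum fun b _ => ?_
          have : 0 < (2 * K)⁻¹ := by positivity
          simp only [w]
          split_ifs <;> linarith
      _ = 1 := by
          rw [Finset.sum_add_distrib, Finset.sum_ite_eq]
          simp only [Finset.mem_univ, if_true, Finset.sum_const, nsmul_eq_mul, Finset.card_univ]
          change 1 / 2 + K * (2 * K)⁻¹ = 1
          field_simp
          norm_num
  set p : A → B × C := fun a => (m a, y a)
  have key : ∑ a, (fiberCard y a / N * w (y a) (m a)) / fiberCard p a ≤ 1 := by
    have e1 : ∀ a, (fiberCard y a / N * w (y a) (m a)) / (fiberCard p a : ℝ) =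
        ∑ x, if y x = y a then N⁻¹ * (w (y a) (m a) * (fiberCard p a : ℝ)⁻¹) else 0 := by
      intro a
      rw [← Finset.sum_filter, Finset.sum_const, nsmul_eq_mul]
      simp only [fiberCard]
      ring
    simp only [e1]
    rw [Finset.sum_comm]
    have e2 : ∀ x, (∑ a, if y x = y a then N⁻¹ * (w (y a) (m a) * (fiberCard p a : ℝ)⁻¹) else 0) ≤
        N⁻¹ := by
      intro x
      calc _ = ∑ b, ∑ a ∈ Finset.univ.filter (fun a => m a = b),
            if y x = y a then N⁻¹ * (w (y a) (m a) * (fiberCard p a : ℝ)⁻¹) else 0 :=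
            (Finset.sum_fiberwise _ _ _).symm
        _ ≤ ∑ b, N⁻¹ * w (y x) b := by
            refine Finset.sum_le_sum fun b _ => ?_
            have := mul_le_mul_of_nonneg_left (sum_inv_fiberCard_le_one p (b, y x))
              (a := N⁻¹ * w (y x) b) (mul_nonneg (by positivity) (hw _ _).le)
            rw [mul_one] at this
            refine le_trans (le_of_eq ?_) this
            rw [Finset.mul_sum, Finset.sum_filter, Finset.sum_filter]
            refine Finset.sum_congr rfl fun a _ => ?_
            by_cases h1 : m a = b <;> by_cases h2 : y x = y a
            · rw [if_pos h1, if_pos h2, if_pos (Prod.ext h1 h2.symm), h1, h2, mul_assoc]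
            · rw [if_pos h1, if_neg h2, if_neg fun he => h2 (congrArg Prod.snd he).symm]
            · rw [if_neg h1, if_neg fun he => h1 (congrArg Prod.fst he)]
            · rw [if_neg h1, if_neg fun he => h1 (congrArg Prod.fst he)]
        _ ≤ N⁻¹ := by
            rw [← Finset.mul_sum]
            exact mul_le_of_le_one_right (by positivity) (hw1 _)
    calc _ ≤ ∑ _x : A, N⁻¹ := Finset.sum_le_sum fun x _ => e2 x
      _ = 1 := by
        rw [Finset.sum_const, nsmul_eq_mul, Finset.card_univ]
        exact mul_inv_cancel₀ hN.ne'
  have hpos : ∀ a, (0 : ℝ) < fiberCard y a / N * w (y a) (m a) := fun a =>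
    mul_pos (div_pos (fiberCard_cast_pos y a) hN) (hw _ _)
  refine (ent_le_cross p _ hpos key).trans (le_of_eq ?_)
  have e3 : ∀ a, -Real.log (fiberCard y a / N * w (y a) (m a)) =
      Real.log (N / fiberCard y a) + Real.log 2 +
        (if g (y a) ≠ m a then 1 else 0) * Real.log K := by
    intro a
    have h1 := (fiberCard_cast_pos y a).ne'
    rw [Real.log_mul (by positivity) (hw _ _).ne', Real.log_div h1 hN.ne',
      Real.log_div hN.ne' h1]
    simp only [w]
    by_cases h2 : g (y a) = m a
    · simp only [h2, if_true, ne_eq, not_true_eq_false, if_false, one_div, Real.log_inv]; ring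
    · simp only [h2, if_false, ne_eq, not_false_eq_true, if_true, Real.log_inv]
      rw [Real.log_mul two_ne_zero hB.ne']; ring
  simp only [e3, Finset.sum_add_distrib, ← Finset.sum_mul]
  rw [Finset.sum_const, nsmul_eq_mul, Finset.card_univ, Finset.sum_boole]
  simp only [ent, N, K]
  field_simp

end Entropy

/-! ### Entropies of the layered channel -/

/-- The blocks `x` with the layers from `a i` on set to zero at time `i`. -/
def topLayers {n q : ℕ} (a : Fin n → ℕ) (x : Fin n → Fin q → ZMod 2) : Fin n → Fin q → ZMod 2 :=
  fun i j => if (j : ℕ) < a i then x i j else 0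

/-- The entropy of the first `a i` layers, `i < n`, of the random block `U`. -/
noncomputable def topEnt {A : Type*} [Fintype A] {n q : ℕ} (U : A → Fin n → Fin q → ZMod 2)
    (a : Fin n → ℕ) : ℝ :=
  ent fun m => topLayers a (U m)

section TopLayers

variable {A : Type*} [Fintype A] {n q : ℕ}

lemma topLayers_eq_iff {a : Fin n → ℕ} {x y : Fin n → Fin q → ZMod 2} :
    topLayers a x = topLayers a y ↔ ∀ i (j : Fin q), (j : ℕ) < a i → x i j = y i j := by
  constructor
  · intro h i j hj
    have := congrFun (congrFun h i) j
    simpa [topLayers, hj] using this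
  · intro h
    funext i j
    by_cases hj : (j : ℕ) < a i
    · simp [topLayers, hj, h i j hj]
    · simp [topLayers, hj]

/-- A random block whose value is determined by `d i` bits at each time `i`, at the positions from
`s i` on, has entropy at most `log 2` per bit. -/
lemma ent_le_of_window [Nonempty A] {B : Type*} (f : A → B) (U : A → Fin n → Fin q → ZMod 2)
    (s d : Fin n → ℕ)
    (h : ∀ a b, (∀ i (j : Fin q), s i ≤ j → (j : ℕ) < s i + d i → U a i j = U b i j) →
      f a = f b) :
    ent f ≤ Real.log 2 * ∑ i, (d i : ℝ) := by
  set w : A → (Σ i : Fin n, Fin (d i)) → ZMod 2 := fun a p =>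
    if hp : s p.1 + p.2 < q then U a p.1 ⟨s p.1 + p.2, hp⟩ else 0
  calc ent f ≤ ent w := by
        refine ent_mono fun a b hab => h a b fun i j h1 h2 => ?_
        have := congrFun hab ⟨i, ⟨j - s i, by omega⟩⟩
        have e : s i + (j - s i) = (j : ℕ) := by omega
        simpa [w, e] using this
    _ ≤ Real.log (Fintype.card ((Σ i : Fin n, Fin (d i)) → ZMod 2)) := ent_le_log_card w
    _ = Real.log 2 * ∑ i, (d i : ℝ) := by
        rw [Fintype.card_fun, ZMod.card, Fintype.card_sigma]
        simp only [Fintype.card_fin]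
        push_cast
        rw [← Nat.cast_sum, Real.log_pow, mul_comm]

lemma topEnt_mono (U : A → Fin n → Fin q → ZMod 2) : Monotone (topEnt U) := by
  intro a b hab
  refine ent_mono fun x y => ?_
  simp only [topLayers_eq_iff]
  exact fun h i j hj => h i j (hj.trans_le (hab i))

lemma topEnt_submod (U : A → Fin n → Fin q → ZMod 2) : Submod (topEnt U) := by
  intro a b
  have := ent_submod (fun m => topLayers a (U m)) (fun m => topLayers b (U m))
    (fun m => topLayers (a ⊓ b) (U m))
    (fun x y => by
      simp only [topLayers_eq_iff, Pi.inf_apply, lt_inf_iff]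
      exact fun h i j hj => h i j hj.1)
    (fun x y => by
      simp only [topLayers_eq_iff, Pi.inf_apply, lt_inf_iff]
      exact fun h i j hj => h i j hj.2)
  refine le_trans (le_of_eq ?_) this
  congr 1
  refine ent_congr fun x y => ?_
  simp only [Prod.mk.injEq, topLayers_eq_iff, Pi.sup_apply, lt_sup_iff]
  exact ⟨fun h => ⟨fun i j hj => h i j (.inl hj), fun i j hj => h i j (.inr hj)⟩,
    fun h i j hj => hj.elim (h.1 i j) (h.2 i j)⟩

/-- Each further layer adds at most one bit of entropy. -/
lemma monotone_sub_topEnt [Nonempty A] (U : A → Fin n → Fin q → ZMod 2) :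
    Monotone fun v : Fin n → ℕ => Real.log 2 * ∑ i, (v i : ℝ) - topEnt U v := by
  intro u v huv
  have h1 : topEnt U v ≤ topEnt U u + Real.log 2 * ∑ i, ((v i - u i : ℕ) : ℝ) := by
    set g : A → Fin n → Fin q → ZMod 2 := fun m i j =>
      if u i ≤ j ∧ (j : ℕ) < v i then U m i j else 0
    have h2 : ent g ≤ Real.log 2 * ∑ i, ((v i - u i : ℕ) : ℝ) := by
      refine ent_le_of_window g U u (fun i => v i - u i) fun a b h => ?_
      funext i j
      by_cases hj : u i ≤ j ∧ (j : ℕ) < v i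
      · simp only [g, hj, and_self, if_true]
        exact h i j hj.1 (by omega)
      · simp [g, hj]
    have h3 : topEnt U v ≤ ent (fun m => (topLayers u (U m), g m)) := by
      refine ent_mono fun a b hab => topLayers_eq_iff.2 fun i j hj => ?_
      rw [Prod.mk.injEq, topLayers_eq_iff] at hab
      by_cases hu : (j : ℕ) < u i
      · exact hab.1 i j hu
      · have := congrFun (congrFun hab.2 i) j
        simpa [g, hj, not_lt.1 hu] using this
    have h4 := ent_prod_le (fun m => topLayers u (U m)) g
    unfold topEnt at h3 ⊢
    linarith
  have h5 : ∑ i, ((v i - u i : ℕ) : ℝ) = ∑ i, (v i : ℝ) - ∑ i, (u i : ℝ) := by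
    rw [← Finset.sum_sub_distrib]
    exact Finset.sum_congr rfl fun i _ => Nat.cast_sub (huv i)
  rw [h5, mul_sub] at h1
  simp only
  linarith

lemma topEnt_le [Nonempty A] (U : A → Fin n → Fin q → ZMod 2) (a : Fin n → ℕ) :
    topEnt U a ≤ Real.log 2 * ∑ i, (a i : ℝ) :=
  ent_le_of_window _ U (fun _ => 0) a fun x y h =>
    topLayers_eq_iff.2 fun i j hj => h i j (Nat.zero_le _) (by simpa using hj)

end TopLayers

lemma shift_pow_mulVec {q : ℕ} (d : ℕ) (x : Fin q → ZMod 2) (j : Fin q) :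
    (shift q ^ d).mulVec x j = if d ≤ (j : ℕ) then x ⟨j - d, by omega⟩ else 0 := by
  induction d generalizing j with
  | zero => simp
  | succ d ih =>
    rw [pow_succ', ← Matrix.mulVec_mulVec]
    simp only [Matrix.mulVec, dotProduct, shift, Matrix.of_apply, ite_mul, one_mul, zero_mul]
    simp only [Matrix.mulVec, dotProduct, shift] at ih
    by_cases h : d + 1 ≤ (j : ℕ)
    · rw [if_pos h, Finset.sum_eq_single ⟨j - 1, by omega⟩]
      · rw [if_pos (by simp only; omega), ih, if_pos (by simp only; omega)]
        congr 2
        simp only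
        omega
      · intro b _ hb
        rw [if_neg]
        intro hb'
        exact hb (Fin.ext (by simp only; omega))
      · simp
    · rw [if_neg h]
      refine Finset.sum_eq_zero fun b _ => ?_
      split_ifs with hb
      · rw [ih, if_neg (by omega)]
      · rfl

lemma other_ne (k : Fin 2) : other k ≠ k := by
  fin_cases k <;> decide

lemma other_other (k : Fin 2) : other (other k) = k := by
  fin_cases k <;> decide

lemma received_eq {q : ℕ} (k : Fin 2) (a : Fin 2 → Fin (q + 1)) (x : Fin 2 → Fin q → ZMod 2) :
    received a x = (shift q ^ (q - (a k : ℕ))).mulVec (x k) +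
      (shift q ^ (q - (a (other k) : ℕ))).mulVec (x (other k)) := by
  fin_cases k
  · rfl
  · exact add_comm _ _

/-- The shifted signal and the layers that survive the shift determine each other. -/
lemma shift_mulVec_eq_iff {q : ℕ} (a : Fin (q + 1)) (x y : Fin q → ZMod 2) :
    (shift q ^ (q - (a : ℕ))).mulVec x = (shift q ^ (q - (a : ℕ))).mulVec y ↔
      ∀ j : Fin q, (j : ℕ) < a → x j = y j := by
  have ha := a.is_le
  constructor
  · intro h j hj
    have := congrFun h ⟨j + (q - a), by omega⟩
    simpa [shift_pow_mulVec] using this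
  · intro h
    funext j
    rw [shift_pow_mulVec, shift_pow_mulVec]
    split_ifs with hj
    · exact h _ (by simp only; omega)
    · rfl

/-- The block received when the fading levels are `a t i` and transmitter `t` sends `x t`. -/
def recvBlock {n q : ℕ} (a : Fin 2 → Fin n → Fin (q + 1)) (x : Fin 2 → Fin n → Fin q → ZMod 2) :
    Fin n → Fin q → ZMod 2 :=
  fun i => received (fun t => a t i) (fun t => x t i)

section Received

variable {A : Type*} [Fintype A] {n q : ℕ} (U : Fin 2 → A → Fin n → Fin q → ZMod 2)
  (a : Fin 2 → Fin n → Fin (q + 1))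

/-- The entropy of the block received over the fading levels `a`. -/
noncomputable def recvEnt : ℝ := ent fun m => recvBlock a fun t => U t m

/-- If the signal of transmitter `k` is known, then the received block and the layers that arrive
from the other transmitter determine each other. -/
lemma recvBlock_eq_iff (k : Fin 2) {x y : Fin 2 → Fin n → Fin q → ZMod 2} (h : x k = y k) :
    recvBlock a x = recvBlock a y ↔ topLayers (fun i => (a (other k) i : ℕ)) (x (other k)) =
      topLayers (fun i => (a (other k) i : ℕ)) (y (other k)) := by
  rw [topLayers_eq_iff, funext_iff]
  refine forall_congr' fun i => ?_
  simp only [recvBlock]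
  rw [received_eq k, received_eq k, h, add_right_inj, shift_mulVec_eq_iff]

/-- The received block consists of the uncovered top layers of one transmitter and of as many
lower bits as arrive from the other one. -/
lemma recvEnt_le [Nonempty A] (t : Fin 2) :
    recvEnt U a ≤ topEnt (U (other t)) (fun i => (a (other t) i : ℕ) - (a t i : ℕ)) +
      Real.log 2 * ∑ i, ((a t i : ℕ) : ℝ) := by
  set Y : A → Fin n → Fin q → ZMod 2 := fun m => recvBlock a fun t => U t m with hY
  set low : A → Fin n → Fin q → ZMod 2 := fun m i j => if q - (a t i : ℕ) ≤ j then Y m i j else 0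
  have h1 : ent low ≤ Real.log 2 * ∑ i, ((a t i : ℕ) : ℝ) := by
    refine ent_le_of_window low Y (fun i => q - a t i) (fun i => a t i) fun x y h => ?_
    funext i j
    simp only [low]
    split_ifs with hj
    · exact h i j hj (by have := (a t i).is_le; omega)
    · rfl
  set top : A → Fin n → Fin q → ZMod 2 := fun m =>
    topLayers (fun i => (a (other t) i : ℕ) - (a t i : ℕ)) (U (other t) m)
  have h2 : recvEnt U a ≤ ent (fun m => (top m, low m)) := by
    refine ent_mono fun x y hxy => ?_
    rw [Prod.mk.injEq, topLayers_eq_iff] at hxy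
    funext i j
    by_cases hj : q - (a t i : ℕ) ≤ j
    · have := congrFun (congrFun hxy.2 i) j
      simpa only [low, hj, if_true] using this
    · simp only [recvBlock]
      rw [received_eq t, received_eq t, Pi.add_apply, Pi.add_apply]
      simp only [shift_pow_mulVec]
      rw [if_neg hj, if_neg hj]
      split_ifs with hj'
      · refine congrArg (0 + ·) (hxy.1 i _ ?_)
        have := (a (other t) i).is_le
        simp only
        omega
      · rfl
  have h3 := ent_prod_le top low
  unfold topEnt
  linarith

/-- The received block is determined by the arriving layers of both transmitters. -/
lemma recvEnt_le_add [Nonempty A] (t : Fin 2) :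
    recvEnt U a ≤ topEnt (U t) (fun i => (a t i : ℕ)) +
      topEnt (U (other t)) (fun i => (a (other t) i : ℕ)) := by
  refine le_trans (ent_mono fun x y hxy => ?_) (ent_prod_le _ _)
  rw [Prod.mk.injEq, topLayers_eq_iff, topLayers_eq_iff] at hxy
  funext i
  simp only [recvBlock]
  rw [received_eq t, received_eq t, (shift_mulVec_eq_iff _ _ _).2 (hxy.1 i),
    (shift_mulVec_eq_iff _ _ _).2 (hxy.2 i)]

end Received

section Codes

variable {q n : ℕ} {M : Fin 2 → ℕ}

/-- The message of user `r` is uniform and independent of functions of the other message. -/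
lemma log_add_ent_le {C : Type*} (hM : ∀ k, 0 < M k) (r : Fin 2) (f : Fin (M (other r)) → C) :
    Real.log (M r) + ent (fun m : (k : Fin 2) → Fin (M k) => f (m (other r))) ≤
      ent (fun m : (k : Fin 2) → Fin (M k) => (m r, f (m (other r)))) := by
  classical
  have hne : ∀ k, Nonempty (Fin (M k)) := fun k => ⟨⟨0, hM k⟩⟩
  set A := (k : Fin 2) → Fin (M k)
  have hA : (0 : ℝ) < Fintype.card A := by exact_mod_cast Fintype.card_pos
  have hMr : (0 : ℝ) < M r := by exact_mod_cast hM r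
  have key : ∀ m : A, M r * fiberCard (fun m : A => (m r, f (m (other r)))) m ≤
      fiberCard (fun m : A => f (m (other r))) m := by
    intro m
    simp only [fiberCard]
    have e : ∀ s : Finset A, M r * s.card = ((Finset.univ : Finset (Fin (M r))) ×ˢ s).card := by
      simp
    rw [e]
    refine Finset.card_le_card_of_injOn (fun p => Function.update p.2 r p.1) ?_ ?_
    · rintro ⟨b, x⟩ hx
      have hx' : x r = m r ∧ f (x (other r)) = f (m (other r)) := by simpa using hx
      simp [Function.update_of_ne (other_ne r), hx'.2]
    · rintro ⟨b, x⟩ hx ⟨b', x'⟩ hx' h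
      have h1 : x r = m r ∧ f (x (other r)) = f (m (other r)) := by simpa using hx
      have h2 : x' r = m r ∧ f (x' (other r)) = f (m (other r)) := by simpa using hx'
      simp only at h
      have hb : b = b' := by simpa using congrFun h r
      refine Prod.ext hb (funext fun k => ?_)
      by_cases hk : k = r
      · subst hk; exact h1.1.trans h2.1.symm
      · simpa [Function.update_of_ne hk] using congrFun h k
  have hlog : Real.log (M r) = (Fintype.card A : ℝ)⁻¹ * ∑ _m : A, Real.log (M r) := by
    rw [Finset.sum_const, nsmul_eq_mul, Finset.card_univ, inv_mul_cancel_left₀ hA.ne']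
  rw [hlog]
  simp only [ent]
  rw [← mul_add, ← Finset.sum_add_distrib]
  refine mul_le_mul_of_nonneg_left (Finset.sum_le_sum fun m _ => ?_) (by positivity)
  have h1 := fiberCard_cast_pos (fun m : A => f (m (other r))) m
  have h2 := fiberCard_cast_pos (fun m : A => (m r, f (m (other r)))) m
  rw [← Real.log_mul hMr.ne' (by positivity)]
  refine Real.log_le_log (by positivity) ?_
  rw [← mul_div_assoc, div_le_div_iff₀ h1 h2]
  have : (M r * fiberCard (fun m : A => (m r, f (m (other r)))) m : ℝ) ≤
      fiberCard (fun m : A => f (m (other r))) m := by exact_mod_cast key m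
  nlinarith

/-- The codewords of the two users as functions of the pair of messages. -/
def Code.word (c : Code q n M) (k : Fin 2) (m : (k : Fin 2) → Fin (M k)) :
    Fin n → Fin q → ZMod 2 :=
  c.enc k (m k)

open Classical in
/-- The error probability of receiver `r` when the fading levels towards it are `a`. -/
noncomputable def Code.condError (c : Code q n M) (r : Fin 2) (a : Fin 2 → Fin n → Fin (q + 1)) :
    ℝ :=
  (Fintype.card ((k : Fin 2) → Fin (M k)) : ℝ)⁻¹ * (Finset.univ.filter
    fun m : (k : Fin 2) → Fin (M k) => c.dec r (recvBlock a fun t => c.word t m) a ≠ m r).card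

/-- The converse for one receiver and given fading levels: by Fano's inequality the rate is at most
the entropy of the received block minus the entropy of the interference. -/
lemma Code.log_card_le (c : Code q n M) (hM : ∀ k, 0 < M k) (r : Fin 2)
    (a : Fin 2 → Fin n → Fin (q + 1)) :
    Real.log (M r) + topEnt (c.word (other r)) (fun i => (a (other r) i : ℕ)) ≤
      recvEnt c.word a + Real.log 2 + c.condError r a * Real.log (M r) := by
  have hne : ∀ k, Nonempty (Fin (M k)) := fun k => ⟨⟨0, hM k⟩⟩
  have h1 := ent_fano (fun m : (k : Fin 2) → Fin (M k) => m r)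
    (fun m => recvBlock a fun t => c.word t m) (fun y => c.dec r y a)
  have h2 := log_add_ent_le hM r
    (fun x => topLayers (fun i => (a (other r) i : ℕ)) (c.enc (other r) x))
  have h3 : ent (fun m : (k : Fin 2) → Fin (M k) => (m r, recvBlock a fun t => c.word t m)) =
      ent (fun m : (k : Fin 2) → Fin (M k) =>
        (m r, topLayers (fun i => (a (other r) i : ℕ)) (c.enc (other r) (m (other r))))) := by
    refine ent_congr fun x y => ?_
    rw [Prod.mk.injEq, Prod.mk.injEq]
    refine and_congr_right fun hr => ?_
    refine (recvBlock_eq_iff a r ?_)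
    simp only [Code.word]
    rw [hr]
  rw [h3, Fintype.card_fin] at h1
  refine (h2.trans h1).trans (le_of_eq ?_)
  simp only [recvEnt, Code.condError]
  congr!

end Codes

/-! ### The law of the fading levels -/

open MeasureTheory ProbabilityTheory

/-- Grouping the members of an independent family gives an independent family of families. -/
lemma iIndepFun_curry {Ω ι κ : Type*} [MeasurableSpace Ω] {P : Measure Ω} {E : Type*}
    [MeasurableSpace E] {X : ι → κ → Ω → E} (mX : ∀ i j, Measurable (X i j))
    (h : iIndepFun (fun (p : (_ : ι) × κ) ω => X p.1 p.2 ω) P) :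
    iIndepFun (fun i ω => (X i · ω)) P := by
  have := h.isProbabilityMeasure
  have hp : ∀ i j, IsProbabilityMeasure (P.map (X i j)) :=
    fun i j => Measure.isProbabilityMeasure_map (mX i j).aemeasurable
  have h2 : ∀ i, iIndepFun (X i) P := fun i =>
    h.precomp (g := fun j => (⟨i, j⟩ : (_ : ι) × κ)) fun a b hab => by simpa using hab
  have e : (MeasurableEquiv.piCurry fun (_ : ι) (_ : κ) => E) ∘ (fun ω p => X p.1 p.2 ω) =
      fun ω i j => X i j ω := by
    ext; simp [Sigma.curry]
  rw [iIndepFun_iff_map_fun_eq_infinitePi_map (by fun_prop), ← e,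
    ← Measure.map_map (by fun_prop) (by fun_prop),
    (iIndepFun_iff_map_fun_eq_infinitePi_map (by fun_prop)).1 h,
    Measure.infinitePi_map_piCurry (fun i j => P.map (X i j))]
  congrm Measure.infinitePi fun i => ?_
  rw [(iIndepFun_iff_map_fun_eq_infinitePi_map (by fun_prop)).1 (h2 i)]

section Converse

variable {Ω : Type*} [MeasurableSpace Ω] {P : Measure Ω} [IsProbabilityMeasure P] {q : ℕ}

/-- The tail function of a natural number valued random variable. -/
noncomputable def natTail (P : Measure Ω) (X : Ω → ℕ) (l : ℕ) : ℝ :=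
  P.real {ω | l ≤ X ω}

lemma isTail_natTail {X : Ω → ℕ} (hX : ∀ ω, X ω ≤ q) : IsTail q (natTail P X) where
  zero := by simp [natTail]
  top := by
    have : {ω | q + 1 ≤ X ω} = ∅ := by
      ext ω
      have := hX ω
      simp only [Set.mem_ofPred_eq, Set.mem_empty_iff_false, iff_false]
      omega
    rw [natTail, this, measureReal_empty]
  anti := fun _ _ h => measureReal_mono fun _ hω => le_trans h hω

lemma natTail_sub_succ {X : Ω → ℕ} (hX : Measurable X) (l : ℕ) :
    natTail P X l - natTail P X (l + 1) = P.real (X ⁻¹' {l}) := by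
  have hsub : {ω | l + 1 ≤ X ω} ⊆ {ω | l ≤ X ω} := fun ω hω => le_trans (Nat.le_succ l) hω
  rw [natTail, natTail, ← measureReal_sdiff hsub (hX (measurableSet_Ici (a := l + 1)))]
  congr 1
  ext ω
  simp only [Set.mem_sdiff, Set.mem_ofPred_eq, Set.mem_preimage, Set.mem_singleton_iff]
  omega

/-- Independent identically distributed levels are averaged over by `levelAvg`. -/
lemma integral_eq_levelAvg {Z : ℕ → Ω → ℕ} (hZ : ∀ i, Measurable (Z i)) (hq : ∀ i ω, Z i ω ≤ q)
    (hind : iIndepFun Z P) (hid : ∀ i, IdentDistrib (Z i) (Z 0) P P) {n : ℕ}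
    (φ : (Fin n → ℕ) → ℝ) :
    ∫ ω, φ (fun i => Z i ω) ∂P = levelAvg q (natTail P (Z 0)) φ := by
  set V : Ω → Fin n → Fin (q + 1) := fun ω i => ⟨Z i ω, Nat.lt_succ_of_le (hq i ω)⟩
  have hV : Measurable V := by
    refine measurable_pi_lambda _ fun i => measurable_to_countable' fun l => ?_
    have : (fun ω => V ω i) ⁻¹' {l} = Z i ⁻¹' {(l : ℕ)} := by
      ext ω; simp [V, Fin.ext_iff]
    rw [this]
    exact hZ i (measurableSet_singleton _)
  have h1 : ∫ ω, φ (fun i => Z i ω) ∂P = ∫ v, φ (fun i => (v i : ℕ)) ∂(P.map V) := by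
    rw [integral_map hV.aemeasurable (Measurable.of_discrete).aestronglyMeasurable]
  have := Measure.isProbabilityMeasure_map (μ := P) hV.aemeasurable
  rw [h1, integral_fintype .of_finite]
  refine Finset.sum_congr rfl fun v _ => ?_
  rw [smul_eq_mul]
  congr 1
  rw [map_measureReal_apply hV (measurableSet_singleton _)]
  have e : V ⁻¹' {v} = ⋂ i : Fin n, Z i ⁻¹' {(v i : ℕ)} := by
    ext ω; simp [V, funext_iff, Fin.ext_iff]
  have h2 := (hind.precomp (g := fun i : Fin n => (i : ℕ)) Fin.val_injective).meas_iInter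
    (s := fun i : Fin n => Z i ⁻¹' {(v i : ℕ)}) fun i => ⟨_, measurableSet_singleton _, rfl⟩
  rw [e, measureReal_def, h2, ENNReal.toReal_prod]
  refine Finset.prod_congr rfl fun i _ => ?_
  rw [natTail_sub_succ (hZ 0), measureReal_def, (hid i).measure_preimage_eq (measurableSet_singleton _)]

section Fading

variable {N : Fin 2 → Fin 2 → ℕ → Ω → Fin (q + 1)} (hmeas : ∀ t r i, Measurable (N t r i))
  (hindep : iIndepFun (fun a : Fin 2 × Fin 2 × ℕ => N a.1 a.2.1 a.2.2) P)
  (hident : ∀ t r i, IdentDistrib (N t r i) (N t r 0) P P)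

include hmeas hindep hident in
/-- A function of the two levels towards receiver `r` is independent and identically distributed
over time, even though it may depend on both levels. -/
lemma integral_fading_eq_levelAvg (r : Fin 2) (g : (Fin 2 → Fin (q + 1)) → ℕ) (hg : ∀ a, g a ≤ q)
    {n : ℕ} (φ : (Fin n → ℕ) → ℝ) :
    ∫ ω, φ (fun i => g fun t => N t r i ω) ∂P =
      levelAvg q (natTail P fun ω => g fun t => N t r 0 ω) φ := by
  have hgm : Measurable g := .of_discrete
  have hv : ∀ i, Measurable fun ω => fun t => N t r i ω :=
    fun i => measurable_pi_lambda _ fun t => hmeas t r i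
  have h1 : iIndepFun (fun i ω => ((fun i t => N t r i) i · ω)) P :=
    iIndepFun_curry (fun i t => hmeas t r i)
      (hindep.precomp (g := fun p : (_ : ℕ) × Fin 2 => (p.2, r, p.1)) fun x y h => by
        simp only [Prod.mk.injEq, true_and] at h
        exact Sigma.ext h.2 (heq_of_eq h.1))
  have h2 : ∀ i, iIndepFun (fun t => N t r i) P := fun i =>
    hindep.precomp (g := fun t : Fin 2 => (t, r, i)) fun x y h => congrArg Prod.fst h
  refine integral_eq_levelAvg (Z := fun i ω => g fun t => N t r i ω)
    (fun i => hgm.comp (hv i)) (fun i ω => hg _) (h1.comp (fun _ => g) fun _ => hgm)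
    (fun i => IdentDistrib.comp (u := g) ⟨(hv i).aemeasurable, (hv 0).aemeasurable, ?_⟩ hgm) φ
  rw [(h2 i).map_fun_eq_pi_map fun t => (hmeas t r i).aemeasurable,
    (h2 0).map_fun_eq_pi_map fun t => (hmeas t r 0).aemeasurable]
  congr 1
  funext t
  exact (hident t r i).map_eq

include hmeas in
lemma measurable_fading (n : ℕ) (r : Fin 2) :
    Measurable fun ω => fun (t : Fin 2) (i : Fin n) => N t r i ω :=
  measurable_pi_lambda _ fun t => measurable_pi_lambda _ fun i => hmeas t r i

include hmeas in
lemma integrable_fading {n : ℕ} (r : Fin 2) (G : (Fin 2 → Fin n → Fin (q + 1)) → ℝ) :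
    Integrable (fun ω => G fun t i => N t r i ω) P := by
  have hV := measurable_fading hmeas n r
  have := Measure.isProbabilityMeasure_map (μ := P) hV.aemeasurable
  exact (Integrable.of_finite (μ := P.map _) (f := G)).comp_measurable hV

variable {n : ℕ} {M : Fin 2 → ℕ} (c : Code q n M)

include hmeas in
/-- The error probability of one receiver is at most that of both. -/
lemma Code.integral_condError_le (r : Fin 2) :
    ∫ ω, c.condError r (fun t i => N t r i ω) ∂P ≤ c.errorProb P N := by
  classical
  have hset : ∀ m : (k : Fin 2) → Fin (M k), MeasurableSet {ω | c.decoded N m ω r ≠ m r} := by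
    intro m
    exact measurable_fading hmeas n r (MeasurableSet.of_discrete
      (s := {a | c.dec r (recvBlock a fun t => c.word t m) a ≠ m r}))
  have e : ∀ ω, c.condError r (fun t i => N t r i ω) = ((M 0 : ℝ) * (M 1 : ℝ))⁻¹ *
      ∑ m : (k : Fin 2) → Fin (M k), {ω | c.decoded N m ω r ≠ m r}.indicator (fun _ => 1) ω := by
    intro ω
    rw [Code.condError, Fintype.card_pi, Fin.prod_univ_two, Fintype.card_fin, Fintype.card_fin,
      Nat.cast_mul, Finset.card_filter, Nat.cast_sum]
    congr 1
    refine Finset.sum_congr rfl fun m _ => ?_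
    simp only [Set.indicator_apply, Set.mem_ofPred_eq, Nat.cast_ite, Nat.cast_one,
      Nat.cast_zero]
    congr
  simp only [e]
  rw [integral_const_mul, integral_finsetSum _ fun m _ =>
    (integrable_const (1 : ℝ)).indicator (hset m)]
  refine mul_le_mul_of_nonneg_left (Finset.sum_le_sum fun m _ => ?_) (by positivity)
  rw [integral_indicator_const _ (hset m), smul_eq_mul, mul_one]
  exact measureReal_mono fun ω hω => ⟨r, hω⟩

/-! ### Entropy inequalities for a code -/

/-- The average entropy of the top layers of user `k`, when their numbers are independent over time
with the tail function `p`. -/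
noncomputable def Code.topAvg (c : Code q n M) (k : Fin 2) (p : ℕ → ℝ) : ℝ :=
  levelAvg q p (topEnt (c.word k))

/-- The entropy of the block at receiver `r` given the fading. -/
noncomputable def Code.outputEnt (c : Code q n M) (P : Measure Ω)
    (N : Fin 2 → Fin 2 → ℕ → Ω → Fin (q + 1)) (r : Fin 2) : ℝ :=
  ∫ ω, recvEnt c.word (fun t (i : Fin n) => N t r i ω) ∂P

/-- The tail function of the number of layers that reach receiver `r` from transmitter `t`. -/
noncomputable def levelTail (P : Measure Ω) (N : Fin 2 → Fin 2 → ℕ → Ω → Fin (q + 1))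
    (t r : Fin 2) : ℕ → ℝ :=
  natTail P fun ω => (N t r 0 ω : ℕ)

/-- The tail function of the number of layers of the other transmitter that reach receiver `r` above
all layers of transmitter `t`. The natural number subtraction truncates to the positive part. -/
noncomputable def excessTail (P : Measure Ω) (N : Fin 2 → Fin 2 → ℕ → Ω → Fin (q + 1))
    (t r : Fin 2) : ℕ → ℝ :=
  natTail P fun ω => (N (other t) r 0 ω : ℕ) - (N t r 0 ω : ℕ)

lemma isTail_levelTail (t r : Fin 2) : IsTail q (levelTail P N t r) :=
  isTail_natTail fun ω => (N t r 0 ω).is_le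

lemma isTail_excessTail (t r : Fin 2) : IsTail q (excessTail P N t r) :=
  isTail_natTail fun ω => (Nat.sub_le _ _).trans (N (other t) r 0 ω).is_le

include hmeas hindep hident in
lemma integral_level (t r : Fin 2) (φ : (Fin n → ℕ) → ℝ) :
    ∫ ω, φ (fun i => (N t r i ω : ℕ)) ∂P = levelAvg q (levelTail P N t r) φ :=
  integral_fading_eq_levelAvg hmeas hindep hident r (fun a => (a t : ℕ)) (fun a => (a t).is_le) φ

include hmeas hindep hident in
lemma integral_excess (t r : Fin 2) (φ : (Fin n → ℕ) → ℝ) :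
    ∫ ω, φ (fun i => (N (other t) r i ω : ℕ) - (N t r i ω : ℕ)) ∂P =
      levelAvg q (excessTail P N t r) φ :=
  integral_fading_eq_levelAvg hmeas hindep hident r (fun a => (a (other t) : ℕ) - (a t : ℕ))
    (fun a => (Nat.sub_le _ _).trans (a (other t)).is_le) φ

include hmeas hindep hident in
lemma Code.log_card_add_topAvg_le (hM : ∀ k, 0 < M k) (r : Fin 2) :
    Real.log (M r) + c.topAvg (other r) (levelTail P N (other r) r) ≤
      c.outputEnt P N r + Real.log 2 + c.errorProb P N * Real.log (M r) := by
  have hL : 0 ≤ Real.log (M r) := Real.log_natCast_nonneg _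
  have i1 := integrable_fading (P := P) hmeas r
    (fun a : Fin 2 → Fin n → Fin (q + 1) => topEnt (c.word (other r)) fun i => (a (other r) i : ℕ))
  have i2 := integrable_fading (P := P) hmeas r
    (fun a : Fin 2 → Fin n → Fin (q + 1) => recvEnt c.word a)
  have i3 := integrable_fading (P := P) hmeas r
    (fun a : Fin 2 → Fin n → Fin (q + 1) => c.condError r a)
  have h := integral_mono ((integrable_const (μ := P) (Real.log (M r))).add i1)
    ((i2.add (integrable_const (Real.log 2))).add (i3.mul_const (Real.log (M r))))
    fun ω => c.log_card_le hM r fun t i => N t r i ω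
  rw [integral_add' (integrable_const _) i1, integral_add' (i2.add (integrable_const _))
    (i3.mul_const _), integral_add' i2 (integrable_const _), integral_mul_const,
    integral_level hmeas hindep hident] at h
  simp only [integral_const, probReal_univ, one_smul] at h
  exact h.trans (add_le_add_right (mul_le_mul_of_nonneg_right
    (c.integral_condError_le hmeas r) hL) _)

include hmeas hindep hident in
lemma Code.outputEnt_le (hM : ∀ k, 0 < M k) (t r : Fin 2) :
    c.outputEnt P N r ≤ c.topAvg (other t) (excessTail P N t r) +
      n * Real.log 2 * ∑ l ∈ Finset.Icc 1 q, levelTail P N t r l := by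
  have hne : ∀ k, Nonempty (Fin (M k)) := fun k => ⟨⟨0, hM k⟩⟩
  have i1 := integrable_fading (P := P) hmeas r
    (fun a : Fin 2 → Fin n → Fin (q + 1) => recvEnt c.word a)
  have i2 := integrable_fading (P := P) hmeas r
    (fun a : Fin 2 → Fin n → Fin (q + 1) =>
      topEnt (c.word (other t)) fun i => (a (other t) i : ℕ) - (a t i : ℕ))
  have i3 := integrable_fading (P := P) hmeas r
    (fun a : Fin 2 → Fin n → Fin (q + 1) => ∑ i, ((a t i : ℕ) : ℝ))
  have h := integral_mono i1 (i2.add (i3.const_mul (Real.log 2)))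
    fun ω => recvEnt_le c.word (fun t i => N t r i ω) t
  rw [integral_add' i2 (i3.const_mul _), integral_const_mul,
    integral_excess hmeas hindep hident,
    integral_level hmeas hindep hident t r fun v => ∑ i, (v i : ℝ),
    levelAvg_sum_levels (isTail_levelTail t r)] at h
  refine h.trans (le_of_eq ?_)
  rw [Code.topAvg]
  ring

include hmeas hindep hident in
lemma Code.outputEnt_le_add (hM : ∀ k, 0 < M k) (r : Fin 2) :
    c.outputEnt P N r ≤ c.topAvg r (levelTail P N r r) +
      c.topAvg (other r) (levelTail P N (other r) r) := by
  have hne : ∀ k, Nonempty (Fin (M k)) := fun k => ⟨⟨0, hM k⟩⟩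
  have i1 := integrable_fading (P := P) hmeas r
    (fun a : Fin 2 → Fin n → Fin (q + 1) => recvEnt c.word a)
  have i2 := integrable_fading (P := P) hmeas r
    (fun a : Fin 2 → Fin n → Fin (q + 1) => topEnt (c.word r) fun i => (a r i : ℕ))
  have i3 := integrable_fading (P := P) hmeas r
    (fun a : Fin 2 → Fin n → Fin (q + 1) => topEnt (c.word (other r)) fun i => (a (other r) i : ℕ))
  have h := integral_mono i1 (i2.add i3) fun ω => recvEnt_le_add c.word (fun t i => N t r i ω) r
  rwa [integral_add' i2 i3, integral_level hmeas hindep hident,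
    integral_level hmeas hindep hident] at h

lemma Code.topAvg_compare (hM : ∀ k, 0 < M k) (k : Fin 2) {a b d : ℕ → ℝ} (ha : IsTail q a)
    (hb : IsTail q b) (hd : IsTail q d) {w : ℝ} (h0 : 0 ≤ w) (h1 : w ≤ 1) :
    w * c.topAvg k a + (1 - w) * c.topAvg k d - c.topAvg k b ≤
      n * Real.log 2 * ∑ l ∈ Finset.Icc 1 q, max (w * max (a l - d l) 0 - (b l - d l)) 0 :=
  have _hne : ∀ k, Nonempty (Fin (M k)) := fun k => ⟨⟨0, hM k⟩⟩
  levelAvg_compare ha hb hd h0 h1 (topEnt_submod _) (topEnt_mono _) (monotone_sub_topEnt _)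

lemma Code.topAvg_nonneg (k : Fin 2) {p : ℕ → ℝ} (hp : IsTail q p) : 0 ≤ c.topAvg k p := by
  rw [← levelAvg_const (n := n) hp 0]
  exact levelAvg_mono_fun hp fun v => ent_nonneg _

lemma Code.topAvg_le (hM : ∀ k, 0 < M k) (k : Fin 2) {p : ℕ → ℝ} (hp : IsTail q p) :
    c.topAvg k p ≤ n * Real.log 2 * ∑ l ∈ Finset.Icc 1 q, p l := by
  have hne : ∀ k, Nonempty (Fin (M k)) := fun k => ⟨⟨0, hM k⟩⟩
  refine (levelAvg_mono_fun hp fun v => topEnt_le (c.word k) v).trans (le_of_eq ?_)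
  rw [levelAvg_mul, levelAvg_sum_levels hp]
  ring

lemma Code.topAvg_sub_le (hM : ∀ k, 0 < M k) (k : Fin 2) {a b : ℕ → ℝ} (ha : IsTail q a)
    (hb : IsTail q b) : c.topAvg k a + n * Real.log 2 * ∑ l ∈ Finset.Icc 1 q, b l ≤
      c.topAvg k b + n * Real.log 2 * ∑ l ∈ Finset.Icc 1 q, max (a l) (b l) := by
  have h := c.topAvg_compare hM k ha hb ha le_rfl zero_le_one
  have e : ∑ l ∈ Finset.Icc 1 q, max (0 * max (a l - a l) 0 - (b l - a l)) 0 =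
      ∑ l ∈ Finset.Icc 1 q, max (a l) (b l) - ∑ l ∈ Finset.Icc 1 q, b l := by
    rw [← Finset.sum_sub_distrib]
    refine Finset.sum_congr rfl fun l _ => ?_
    have : max (a l) (b l) - b l = max (a l - b l) 0 := by
      rw [← max_sub_sub_right, sub_self]
    rw [this]
    exact congrArg₂ max (by ring) rfl
  rw [e] at h
  linarith

/-- The comparison with the tail function of the constant level zero in the place of `d`, in
homogeneous form. -/
lemma Code.topAvg_mul_sub_le (hM : ∀ k, 0 < M k) (k : Fin 2) {a b : ℕ → ℝ} (ha : IsTail q a)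
    (hb : IsTail q b) {u w : ℝ} (h0 : 0 ≤ u) (huw : u ≤ w) :
    u * c.topAvg k a + w * (n * Real.log 2 * ∑ l ∈ Finset.Icc 1 q, b l) ≤
      w * c.topAvg k b + n * Real.log 2 * ∑ l ∈ Finset.Icc 1 q, max (u * a l) (w * b l) := by
  rcases (h0.trans huw).eq_or_lt with rfl | hw
  · obtain rfl : u = 0 := le_antisymm huw h0
    simp
  set z : ℕ → ℝ := fun l => if l = 0 then 1 else 0
  have hz : IsTail q z := ⟨by simp [z], by simp [z], fun i j hij => by
    simp only [z]; split_ifs <;> first | omega | norm_num⟩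
  have h := c.topAvg_compare hM k ha hb hz (div_nonneg h0 hw.le) ((div_le_one hw).2 huw)
  have hF := c.topAvg_nonneg k hz
  have e : w * ∑ l ∈ Finset.Icc 1 q, max (u / w * max (a l - z l) 0 - (b l - z l)) 0 =
      ∑ l ∈ Finset.Icc 1 q, max (u * a l) (w * b l) - w * ∑ l ∈ Finset.Icc 1 q, b l := by
    rw [Finset.mul_sum, Finset.mul_sum, ← Finset.sum_sub_distrib]
    refine Finset.sum_congr rfl fun l hl => ?_
    obtain ⟨h1, h2⟩ := Finset.mem_Icc.1 hl
    have hzl : z l = 0 := if_neg (by omega)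
    have hal : 0 ≤ a l := by
      have := ha.anti (show l ≤ q + 1 by omega)
      rwa [ha.top] at this
    have : max (u * a l) (w * b l) - w * b l = max (u * a l - w * b l) 0 := by
      rw [← max_sub_sub_right, sub_self]
    rw [this, hzl, sub_zero, sub_zero, max_eq_left hal, mul_max_of_nonneg _ _ hw.le, mul_zero]
    congr 1
    field_simp
  have h' := mul_le_mul_of_nonneg_left h hw.le
  rw [mul_left_comm w, e] at h'
  have e2 : w * (u / w * c.topAvg k a + (1 - u / w) * c.topAvg k z - c.topAvg k b) =
      u * c.topAvg k a + (w - u) * c.topAvg k z - w * c.topAvg k b := by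
    field_simp
  rw [e2] at h'
  have := mul_nonneg (sub_nonneg.2 huw) hF
  linarith

end Fading

end Converse

/-! ### From codes to achievable rates -/

section Limit

variable {Ω : Type*} [MeasurableSpace Ω] {P : Measure Ω} {q : ℕ}
  {N : Fin 2 → Fin 2 → ℕ → Ω → Fin (q + 1)}

/-- An inequality for the message numbers of all codes gives, with the error probability tending to
zero and the block length to infinity, an inequality for achievable rates. -/
lemma Achievable.le_of_converse {R : Fin 2 → ℝ} (hR : Achievable P N R) (k : Fin 2) {x w B C : ℝ}
    (hx : 0 ≤ x) (hw : 0 ≤ w)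
    (h : ∀ (n : ℕ) (M : Fin 2 → ℕ) (c : Code q n M), (∀ k, 0 < M k) →
      (1 - c.errorProb P N) * (x * Real.log (M k) + w * Real.log (M (other k))) ≤
        C + n * Real.log 2 * B) :
    x * R k + w * R (other k) ≤ B := by
  obtain ⟨-, c, hc⟩ := hR
  have hlog2 : 0 < Real.log 2 := Real.log_pos one_lt_two
  have hlim1 : Filter.Tendsto (fun n => (1 - (c n).errorProb P N) * (x * R k + w * R (other k)))
      Filter.atTop (nhds ((1 - 0) * (x * R k + w * R (other k)))) :=
    (tendsto_const_nhds.sub hc).mul_const _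
  have hlim2 : Filter.Tendsto (fun n : ℕ => C / Real.log 2 / (n : ℝ) + B) Filter.atTop
      (nhds (0 + B)) :=
    (tendsto_const_div_atTop_nhds_zero_nat _).add_const B
  rw [sub_zero, one_mul] at hlim1
  rw [zero_add] at hlim2
  refine le_of_tendsto_of_tendsto hlim1 hlim2 ?_
  filter_upwards [hc.eventually (gt_mem_nhds zero_lt_one), Filter.eventually_gt_atTop 0]
    with n hn hn0
  have hn0' : (0 : ℝ) < n := Nat.cast_pos.2 hn0
  have hM : ∀ j, 0 < ⌈(2 : ℝ) ^ ((n : ℝ) * R j)⌉₊ := fun j => Nat.ceil_pos.2 (by positivity)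
  have hrate : ∀ j, n * Real.log 2 * R j ≤ Real.log (⌈(2 : ℝ) ^ ((n : ℝ) * R j)⌉₊ : ℝ) := by
    intro j
    calc n * Real.log 2 * R j = Real.log ((2 : ℝ) ^ ((n : ℝ) * R j)) := by
          rw [Real.log_rpow two_pos]; ring
      _ ≤ _ := Real.log_le_log (by positivity) (Nat.le_ceil _)
  have h1 := h n _ (c n) hM
  have h2 : x * (n * Real.log 2 * R k) + w * (n * Real.log 2 * R (other k)) ≤
      x * Real.log (⌈(2 : ℝ) ^ ((n : ℝ) * R k)⌉₊ : ℝ) +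
        w * Real.log (⌈(2 : ℝ) ^ ((n : ℝ) * R (other k))⌉₊ : ℝ) :=
    add_le_add (mul_le_mul_of_nonneg_left (hrate _) hx) (mul_le_mul_of_nonneg_left (hrate _) hw)
  have h3 := (mul_le_mul_of_nonneg_left h2 (sub_pos.2 hn).le).trans h1
  have h4 : (n * Real.log 2) * ((1 - (c n).errorProb P N) * (x * R k + w * R (other k))) ≤
      (n * Real.log 2) * (C / Real.log 2 / n + B) := by
    have e : (n * Real.log 2) * (C / Real.log 2 / n + B) = C + n * Real.log 2 * B := by
      field_simp
    rw [e]
    linarith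
  exact le_of_mul_le_mul_left h4 (by positivity)

lemma isClosed_nonneg : IsClosed (⋂ j, {R : Fin 2 → ℝ | 0 ≤ R j}) :=
  isClosed_iInter fun j => isClosed_le continuous_const (continuous_apply j)

lemma isClosed_rate_le (k : Fin 2) (x w B : ℝ) :
    IsClosed {R : Fin 2 → ℝ | x * R k + w * R (other k) ≤ B} :=
  isClosed_le (by fun_prop) continuous_const

end Limit

/-! ### The bounds in terms of tail functions -/

section Bounds

variable {Ω : Type*} [MeasurableSpace Ω] {P : Measure Ω} {q : ℕ}
  {N : Fin 2 → Fin 2 → ℕ → Ω → Fin (q + 1)}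

lemma tail_level (t r : Fin 2) (l : ℕ) :
    tail P (level (fun t r => N t r 0) t r) l = levelTail P N t r l := by
  simp [tail, level, levelTail, natTail]

lemma tail_level_sub {t s : Fin 2} (hs : s = other t) (r : Fin 2) {l : ℕ} (hl : 1 ≤ l) :
    tail P (level (fun t r => N t r 0) s r - level (fun t r => N t r 0) t r) l =
      excessTail P N t r l := by
  subst hs
  simp only [tail, level, excessTail, natTail, Pi.sub_apply]
  congr 1
  ext ω
  simp only [Set.mem_ofPred_eq]
  omega

/-- The sum common to the second and the third bound. -/
lemma sum_gamma_alpha_eq (k : Fin 2) (w : ℝ) :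
    ∑ l ∈ Finset.Icc 1 q, max (w * gamma P (fun t r => N t r 0) k l -
      alpha P (fun t r => N t r 0) k l) 0 =
    ∑ l ∈ Finset.Icc 1 q, max (w * max (excessTail P N k (other k) l -
      excessTail P N k k l) 0 - (levelTail P N (other k) k l - excessTail P N k k l)) 0 := by
  refine Finset.sum_congr rfl fun l hl => ?_
  have hl1 := (Finset.mem_Icc.1 hl).1
  rw [gamma, alpha, tail_level, tail_level_sub rfl _ hl1, tail_level_sub rfl _ hl1]

variable [IsProbabilityMeasure P] (hmeas : ∀ t r i, Measurable (N t r i))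
  (hindep : iIndepFun (fun a : Fin 2 × Fin 2 × ℕ => N a.1 a.2.1 a.2.2) P)
  (hident : ∀ t r i, IdentDistrib (N t r i) (N t r 0) P P)

include hmeas hindep hident in
lemma mean_level (t r : Fin 2) :
    mean P (level (fun t r => N t r 0) t r) = ∑ l ∈ Finset.Icc 1 q, levelTail P N t r l := by
  have h := integral_level hmeas hindep hident (n := 1) t r fun v => ∑ i, (v i : ℝ)
  rw [levelAvg_sum_levels (isTail_levelTail t r)] at h
  simpa [mean, level] using h

include hmeas hindep hident in
lemma mean_level_sub (t r : Fin 2) :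
    mean P (fun ω => max (level (fun t r => N t r 0) (other t) r ω -
      level (fun t r => N t r 0) t r ω) 0) = ∑ l ∈ Finset.Icc 1 q, excessTail P N t r l := by
  have h := integral_excess hmeas hindep hident (n := 1) t r fun v => ∑ i, (v i : ℝ)
  rw [levelAvg_sum_levels (isTail_excessTail t r)] at h
  simp only [Finset.univ_unique, Finset.sum_singleton, Nat.cast_one, one_mul] at h
  rw [← h]
  refine integral_congr_ae (.of_forall fun ω => ?_)
  have e : ∀ x y : ℕ, ((max ((x : ℤ) - (y : ℤ)) 0 : ℤ) : ℝ) = ((x - y : ℕ) : ℝ) := by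
    intro x y
    have : max ((x : ℤ) - (y : ℤ)) 0 = ((x - y : ℕ) : ℤ) := by omega
    rw [this, Int.cast_natCast]
  exact e _ _

include hmeas hindep hident in
lemma boundA_eq (k : Fin 2) (w : ℝ) : boundA P (fun t r => N t r 0) k w =
    ∑ l ∈ Finset.Icc 1 q, levelTail P N k k l +
      w * ∑ l ∈ Finset.Icc 1 q, excessTail P N k k l +
      ∑ l ∈ Finset.Icc 1 q, max (w * max (levelTail P N (other k) (other k) l -
        excessTail P N k k l) 0 - (levelTail P N (other k) k l - excessTail P N k k l)) 0 := by
  rw [boundA, mean_level hmeas hindep hident, mean_level_sub hmeas hindep hident]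
  congr 1
  refine Finset.sum_congr rfl fun l hl => ?_
  have hl1 := (Finset.mem_Icc.1 hl).1
  rw [beta, alpha, tail_level, tail_level, tail_level_sub rfl _ hl1]

include hmeas hindep hident in
lemma boundB_eq (k : Fin 2) (w : ℝ) : boundB P (fun t r => N t r 0) k w =
    (1 - w) * ∑ l ∈ Finset.Icc 1 q, levelTail P N k k l +
      w * ∑ l ∈ Finset.Icc 1 q, levelTail P N (other k) k l +
      ∑ l ∈ Finset.Icc 1 q, max (w * max (excessTail P N k (other k) l -
        excessTail P N k k l) 0 - (levelTail P N (other k) k l - excessTail P N k k l)) 0 +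
      w * ∑ l ∈ Finset.Icc 1 q,
        max (excessTail P N (other k) k l) (levelTail P N k (other k) l) := by
  rw [boundB, mean_level hmeas hindep hident, mean_level hmeas hindep hident, sum_gamma_alpha_eq]
  congr 2
  refine Finset.sum_congr rfl fun l hl => ?_
  rw [tail_level, tail_level_sub (other_other k).symm _ (Finset.mem_Icc.1 hl).1]

include hmeas hindep hident in
lemma boundC_eq (k : Fin 2) (w u : ℝ) : boundC P (fun t r => N t r 0) k w u =
    ∑ l ∈ Finset.Icc 1 q, levelTail P N k k l +
      w * ∑ l ∈ Finset.Icc 1 q, excessTail P N k k l +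
      ∑ l ∈ Finset.Icc 1 q, max (w * max (excessTail P N k (other k) l -
        excessTail P N k k l) 0 - (levelTail P N (other k) k l - excessTail P N k k l)) 0 +
      ∑ l ∈ Finset.Icc 1 q, max (u * levelTail P N k k l) (w * levelTail P N k (other k) l) := by
  rw [boundC, mean_level hmeas hindep hident, mean_level_sub hmeas hindep hident,
    sum_gamma_alpha_eq]
  simp only [tail_level]

/-! ### The converse -/

section Converse

variable {n : ℕ} {M : Fin 2 → ℕ} (c : Code q n M)

include hmeas hindep hident in
lemma Code.converseA (hM : ∀ k, 0 < M k) (k : Fin 2) {w : ℝ} (hw : w ∈ Set.Icc (0 : ℝ) 1) :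
    (1 - c.errorProb P N) * (1 * Real.log (M k) + w * Real.log (M (other k))) ≤
      (1 + w) * Real.log 2 + n * Real.log 2 * boundA P (fun t r => N t r 0) k w := by
  rw [boundA_eq hmeas hindep hident]
  have f1 := c.log_card_add_topAvg_le hmeas hindep hident hM k
  have f2 := c.log_card_add_topAvg_le hmeas hindep hident hM (other k)
  have h1 := c.outputEnt_le hmeas hindep hident hM k k
  -- The entropy of the interference at receiver `other k` occurs in `f2` and in `h2` and cancels.
  have h2 := c.outputEnt_le_add hmeas hindep hident hM (other k)
  rw [other_other] at f2 h2
  have h3 := c.topAvg_compare hM (other k) (isTail_levelTail (P := P) (N := N) (other k) (other k))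
    (isTail_levelTail (P := P) (N := N) (other k) k)
    (isTail_excessTail (P := P) (N := N) k k) hw.1 hw.2
  have h4 := c.topAvg_le hM (other k) (isTail_excessTail (P := P) (N := N) k k)
  have g1 := mul_le_mul_of_nonneg_left f2 hw.1
  have g2 := mul_le_mul_of_nonneg_left h2 hw.1
  have g3 := mul_le_mul_of_nonneg_left h4 hw.1
  linarith

include hmeas hindep hident in
lemma Code.converseB (hM : ∀ k, 0 < M k) (k : Fin 2) {w : ℝ} (hw : w ∈ Set.Icc (0 : ℝ) 1) :
    (1 - c.errorProb P N) * (1 * Real.log (M k) + w * Real.log (M (other k))) ≤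
      (1 + w) * Real.log 2 + n * Real.log 2 * boundB P (fun t r => N t r 0) k w := by
  rw [boundB_eq hmeas hindep hident]
  have f1 := c.log_card_add_topAvg_le hmeas hindep hident hM k
  have f2 := c.log_card_add_topAvg_le hmeas hindep hident hM (other k)
  -- The output entropy of receiver `k` is split between its two estimates in the ratio `1 - w : w`.
  have h1 := c.outputEnt_le hmeas hindep hident hM k k
  have h2 := c.outputEnt_le hmeas hindep hident hM (other k) k
  have h3 := c.outputEnt_le hmeas hindep hident hM k (other k)
  rw [other_other] at f2 h2
  have h4 := c.topAvg_compare hM (other k) (isTail_excessTail (P := P) (N := N) k (other k))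
    (isTail_levelTail (P := P) (N := N) (other k) k)
    (isTail_excessTail (P := P) (N := N) k k) hw.1 hw.2
  have h5 := c.topAvg_sub_le hM k (isTail_excessTail (P := P) (N := N) (other k) k)
    (isTail_levelTail (P := P) (N := N) k (other k))
  have g1 := mul_le_mul_of_nonneg_left f2 hw.1
  have g2 := mul_le_mul_of_nonneg_left h1 (sub_nonneg.2 hw.2)
  have g3 := mul_le_mul_of_nonneg_left h2 hw.1
  have g4 := mul_le_mul_of_nonneg_left h3 hw.1
  have g5 := mul_le_mul_of_nonneg_left h5 hw.1
  linarith

include hmeas hindep hident in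
lemma Code.converseC (hM : ∀ k, 0 < M k) (k : Fin 2) {w u : ℝ} (hw : w ∈ Set.Icc (0 : ℝ) 1)
    (hu : u ∈ Set.Icc (0 : ℝ) w) :
    (1 - c.errorProb P N) * ((1 + u) * Real.log (M k) + w * Real.log (M (other k))) ≤
      (1 + u + w) * Real.log 2 + n * Real.log 2 * boundC P (fun t r => N t r 0) k w u := by
  rw [boundC_eq hmeas hindep hident]
  have f1 := c.log_card_add_topAvg_le hmeas hindep hident hM k
  have f2 := c.log_card_add_topAvg_le hmeas hindep hident hM (other k)
  have h1 := c.outputEnt_le hmeas hindep hident hM k k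
  -- The extra share `u` of the rate of user `k` is bounded as if there were no interference.
  have h2 := c.outputEnt_le_add hmeas hindep hident hM k
  have h3 := c.outputEnt_le hmeas hindep hident hM k (other k)
  rw [other_other] at f2
  have h4 := c.topAvg_compare hM (other k) (isTail_excessTail (P := P) (N := N) k (other k))
    (isTail_levelTail (P := P) (N := N) (other k) k)
    (isTail_excessTail (P := P) (N := N) k k) hw.1 hw.2
  have h5 := c.topAvg_mul_sub_le hM k (isTail_levelTail (P := P) (N := N) k k)
    (isTail_levelTail (P := P) (N := N) k (other k)) hu.1 hu.2
  have h6 := c.topAvg_le hM (other k) (isTail_excessTail (P := P) (N := N) k k)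
  have g1 := mul_le_mul_of_nonneg_left f2 hw.1
  have g2 := mul_le_mul_of_nonneg_left f1 hu.1
  have g3 := mul_le_mul_of_nonneg_left h2 hu.1
  have g4 := mul_le_mul_of_nonneg_left h3 hw.1
  have g5 := mul_le_mul_of_nonneg_left h6 hw.1
  linarith

end Converse

/-! ### The capacity region -/

include hmeas hindep hident in
lemma capacityRegion_subset_regionA (k : Fin 2) :
    capacityRegion P N ⊆ regionA P (fun t r => N t r 0) k := by
  have hcl : IsClosed (regionA P (fun t r => N t r 0) k) := by
    simp only [regionA, Set.ofPred_and, Set.ofPred_forall]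
    refine isClosed_nonneg.inter (isClosed_biInter fun w _ => ?_)
    simpa only [one_mul] using isClosed_rate_le k 1 w _
  refine closure_minimal (fun R hR => ⟨hR.1, fun w hw => ?_⟩) hcl
  rw [← one_mul (R k)]
  exact hR.le_of_converse k zero_le_one hw.1
    fun n M c hM => c.converseA hmeas hindep hident hM k hw

include hmeas hindep hident in
lemma capacityRegion_subset_regionB (k : Fin 2) :
    capacityRegion P N ⊆ regionB P (fun t r => N t r 0) k := by
  have hcl : IsClosed (regionB P (fun t r => N t r 0) k) := by
    simp only [regionB, Set.ofPred_and, Set.ofPred_forall]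
    refine isClosed_nonneg.inter (isClosed_biInter fun w _ => ?_)
    simpa only [one_mul] using isClosed_rate_le k 1 w _
  refine closure_minimal (fun R hR => ⟨hR.1, fun w hw => ?_⟩) hcl
  rw [← one_mul (R k)]
  exact hR.le_of_converse k zero_le_one hw.1
    fun n M c hM => c.converseB hmeas hindep hident hM k hw

include hmeas hindep hident in
lemma capacityRegion_subset_regionC (k : Fin 2) :
    capacityRegion P N ⊆ regionC P (fun t r => N t r 0) k := by
  have hcl : IsClosed (regionC P (fun t r => N t r 0) k) := by
    simp only [regionC, Set.ofPred_and, Set.ofPred_forall]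
    exact isClosed_nonneg.inter (isClosed_biInter fun w _ => isClosed_biInter fun u _ =>
      isClosed_rate_le k (1 + u) w _)
  refine closure_minimal (fun R hR => ⟨hR.1, fun w hw u hu => ?_⟩) hcl
  exact hR.le_of_converse k (add_nonneg zero_le_one hu.1) hw.1
    fun n M c hM => c.converseC hmeas hindep hident hM k hw hu

end Bounds

end LayeredErasureIC

theorem theorem1 (q : ℕ) {Ω : Type*} [MeasurableSpace Ω] (P : MeasureTheory.Measure Ω)
    [MeasureTheory.IsProbabilityMeasure P]
    (N : Fin 2 → Fin 2 → ℕ → Ω → Fin (q + 1))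
    (hmeas : ∀ t r i, Measurable (N t r i))
    (hindep : ProbabilityTheory.iIndepFun
      (fun a : Fin 2 × Fin 2 × ℕ => N a.1 a.2.1 a.2.2) P)
    (hident : ∀ t r i, ProbabilityTheory.IdentDistrib (N t r i) (N t r 0) P P) :
    LayeredErasureIC.capacityRegion P N ⊆
      LayeredErasureIC.regionA P (fun t r => N t r 0) 0 ∩
      LayeredErasureIC.regionB P (fun t r => N t r 0) 0 ∩
      LayeredErasureIC.regionC P (fun t r => N t r 0) 0 ∩
      LayeredErasureIC.regionA P (fun t r => N t r 0) 1 ∩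
      LayeredErasureIC.regionB P (fun t r => N t r 0) 1 ∩
      LayeredErasureIC.regionC P (fun t r => N t r 0) 1 := by
  have hA := LayeredErasureIC.capacityRegion_subset_regionA hmeas hindep hident
  have hB := LayeredErasureIC.capacityRegion_subset_regionB hmeas hindep hident
  have hC := LayeredErasureIC.capacityRegion_subset_regionC hmeas hindep hident
  exact fun R hR => ⟨⟨⟨⟨⟨hA 0 hR, hB 0 hR⟩, hC 0 hR⟩, hA 1 hR⟩, hB 1 hR⟩, hC 1 hR⟩
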